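/- Let $-\infty\le a<b\le\infty$. Let $\mathcal{HK}$ be the set of functions that are Henstock--Kurzweil integrable on $(a,b)$, and let $\|f\|=\sup_I\left|\int_I f\right|$ be the Alexiewicz norm of $f\in\mathcal{HK}$, where $I$ runs over all intervals $I\subset(a,b)$. Let $\mathcal{NBV}$ be the set of real-valued functions on $[a,b]\subset[-\infty,\infty]$ that are of bounded variation, left continuous, and vanish at $a$; write $Vh$ for the variation of $h$ over $[a,b]$. Let $g_n$ ($n\ge1$) and $g$ be real-valued functions on $[a,b]$, with $g$ of bounded variation. If $[a,b]$ is a compact interval in $\mathbb{R}$, then in order that $f(g_n-g)\in\mathcal{HK}$ for all $n$ and $\|f(g_n-g)\|\to0$ as $n\to\infty$ for every $f\in\mathcal{HK}$, it is necessary and sufficient that (i) $g_n\to g$ in (Lebesgue) measure on $[a,b]$ as $n\to\infty$; (ii) for each $n\ge1$, $g_n$ is equal almost everywhere on $[a,b]$ to a function $h_n\in\mathcal{NBV}$; and (iii) there is $M\in[0,\infty)$ such that $Vh_n\le M$ for all $n\ge1$. If $(a,b)$ is unbounded, the same equivalence holds with (i) replaced by: $g_n\chi_I\to g\chi_I$ in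 measure for each compact interval $I\subset(a,b)$. -/

import Mathlib

open Set Filter Topology MeasureTheory
open scoped NNReal ENNReal

/-- A tagged division of the compact interval `[a, b]` of the extended real line:
division points `a = pt 0 ≤ pt 1 ≤ ⋯ ≤ pt n = b` and tags `tag i ∈ [pt i, pt (i + 1)]`.
Only the indices up to `n` matter. -/
structure HKDivision (a b : EReal) where
  n : ℕ
  pt : ℕ → EReal
  tag : ℕ → EReal
  pt_zero : pt 0 = a
  pt_last : pt n = b
  tag_mem : ∀ i < n, tag i ∈ Icc (pt i) (pt (i + 1))

/-- A gauge on the extended real line: a neighbourhood of every point, which contains the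
points at infinity only if it is attached to them. -/
def IsHKGauge (γ : EReal → Set EReal) : Prop :=
  ∀ x, γ x ∈ 𝓝 x ∧ (x ≠ ⊥ → ⊥ ∉ γ x) ∧ (x ≠ ⊤ → ⊤ ∉ γ x)

/-- The division is `γ`-fine: each division interval lies in the gauge set of its tag. -/
def HKDivision.IsFine {a b : EReal} (D : HKDivision a b) (γ : EReal → Set EReal) : Prop :=
  ∀ i < D.n, Icc (D.pt i) (D.pt (i + 1)) ⊆ γ (D.tag i)

/-- The Riemann sum of `f`, with `f` taken to be `0` at `±∞` and `0 · ∞ = 0`.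
(If the tag is finite and the division is fine for a gauge, the division interval is bounded.) -/
noncomputable def HKDivision.riemannSum {a b : EReal} (D : HKDivision a b) (f : ℝ → ℝ) : ℝ :=
  ∑ i ∈ Finset.range D.n,
    if D.tag i = ⊥ ∨ D.tag i = ⊤ then 0
    else f (D.tag i).toReal * ((D.pt (i + 1)).toReal - (D.pt i).toReal)

/-- `f` is Henstock--Kurzweil integrable over the interval with (possibly infinite) endpoints
`a ≤ b`, with integral `L`. -/
def HasHKIntegral (a b : EReal) (f : ℝ → ℝ) (L : ℝ) : Prop :=
  ∀ ε : ℝ, 0 < ε → ∃ γ : EReal → Set EReal, IsHKGauge γ ∧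
    ∀ D : HKDivision a b, D.IsFine γ → |D.riemannSum f - L| < ε

/-- `f` is Henstock--Kurzweil integrable over the interval with endpoints `a ≤ b`. -/
def HKIntegrable (a b : EReal) (f : ℝ → ℝ) : Prop :=
  ∃ L : ℝ, HasHKIntegral a b f L

open Classical in
/-- The Henstock--Kurzweil integral over the interval with endpoints `a ≤ b`
(`0` if `f` is not integrable). -/
noncomputable def hkIntegral (a b : EReal) (f : ℝ → ℝ) : ℝ :=
  if h : HKIntegrable a b f then h.choose else 0

/-- The Alexiewicz norm of `f` on `(a, b)`: the supremum of `|∫_I f|` over all intervals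
`I ⊆ (a, b)`, that is, over all pairs of endpoints `a ≤ c ≤ d ≤ b`. -/
noncomputable def alexiewiczNorm (a b : EReal) (f : ℝ → ℝ) : ℝ≥0∞ :=
  ⨆ (c : EReal) (d : EReal) (_ : a ≤ c ∧ c ≤ d ∧ d ≤ b), ENNReal.ofReal |hkIntegral c d f|

/-- Normalised bounded variation on `[a, b]`: of bounded variation, left continuous,
and vanishing at `a`. -/
def IsNBV (a b : EReal) (h : EReal → ℝ) : Prop :=
  BoundedVariationOn h (Icc a b) ∧
    (∀ x ∈ Ioc a b, ContinuousWithinAt h (Iic x) x) ∧ h a = 0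

/-- Every `gn n` agrees Lebesgue-almost everywhere on `[a, b]` with some `h n` of normalised
bounded variation, and the variations of the `h n` over `[a, b]` are uniformly bounded. -/
def EquivUniformlyNBV (a b : EReal) (gn : ℕ → EReal → ℝ) : Prop :=
  ∃ h : ℕ → EReal → ℝ,
    (∀ n, IsNBV a b (h n) ∧
      ∀ᵐ x : ℝ, (x : EReal) ∈ Icc a b → gn n (x : EReal) = h n (x : EReal)) ∧
    ∃ M : ℝ≥0, ∀ n, eVariationOn (h n) (Icc a b) ≤ (M : ℝ≥0∞)

/-- For every Henstock--Kurzweil integrable `f` on `(a, b)`, the functions `f (gn n - g)` are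
Henstock--Kurzweil integrable and converge to `0` in the Alexiewicz norm. -/
def ProductsConverge (a b : EReal) (gn : ℕ → EReal → ℝ) (g : EReal → ℝ) : Prop :=
  ∀ f : ℝ → ℝ, HKIntegrable a b f →
    (∀ n, HKIntegrable a b (fun x : ℝ => f x * (gn n (x : EReal) - g (x : EReal)))) ∧
    Tendsto (fun n => alexiewiczNorm a b
      (fun x : ℝ => f x * (gn n (x : EReal) - g (x : EReal)))) atTop (𝓝 0)

/-- Fine divisions exist for every gauge. -/
theorem HKDivision.exists_isFine {a b : EReal} (hab : a ≤ b) {γ : EReal → Set EReal}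
    (hγ : IsHKGauge γ) : ∃ D : HKDivision a b, D.IsFine γ := by
  have snoc : ∀ {x y t : EReal}, (∃ D : HKDivision a x, D.IsFine γ) → t ∈ Icc x y →
      Icc x y ⊆ γ t → ∃ D : HKDivision a y, D.IsFine γ := by
    rintro x y t ⟨D, hD⟩ ht hs
    refine ⟨⟨D.n + 1, fun i => if i ≤ D.n then D.pt i else y,
      fun i => if i < D.n then D.tag i else t, by simp [D.pt_zero], by simp, ?_⟩, ?_⟩
    · intro i hi
      rcases Nat.lt_succ_iff_lt_or_eq.mp hi with h | h
      · simpa [h, h.le, Nat.succ_le_of_lt h] using D.tag_mem i h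
      · subst h; simpa [D.pt_last] using ht
    · intro i hi
      rcases Nat.lt_succ_iff_lt_or_eq.mp hi with h | h
      · simpa [h, h.le, Nat.succ_le_of_lt h] using hD i h
      · subst h; simpa [D.pt_last] using hs
  set S : Set EReal := {x | x ∈ Icc a b ∧ ∃ D : HKDivision a x, D.IsFine γ} with hS
  have haS : a ∈ S := ⟨⟨le_rfl, hab⟩, ⟨0, fun _ => a, fun _ => a, rfl, rfl, by simp⟩,
    by intro i hi; simp at hi⟩
  set c := sSup S with hc
  have hac : a ≤ c := le_sSup haS
  have hcb : c ≤ b := sSup_le fun x hx => hx.1.2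
  have hcS : c ∈ S := by
    rcases hac.eq_or_lt with h | h
    · rwa [← h]
    · obtain ⟨l, hl, hlc⟩ := exists_Ioc_subset_of_mem_nhds (hγ c).1 ⟨a, h⟩
      obtain ⟨x, hxS, hx⟩ := lt_sSup_iff.mp hl
      exact ⟨⟨hac, hcb⟩, snoc hxS.2 ⟨le_sSup hxS, le_rfl⟩
        fun z hz => hlc ⟨hx.trans_le hz.1, hz.2⟩⟩
  rcases hcb.eq_or_lt with h | h
  · rw [← h]; exact hcS.2
  · obtain ⟨u, hu, huc⟩ := exists_Ico_subset_of_mem_nhds (hγ c).1 ⟨b, h⟩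
    obtain ⟨d, hd1, hd2⟩ := exists_between (lt_min hu h)
    have hdu := hd2.trans_le (min_le_left _ _)
    have hdb := hd2.trans_le (min_le_right _ _)
    have : d ∈ S := ⟨⟨hac.trans hd1.le, hdb.le⟩, snoc hcS.2 ⟨le_rfl, hd1.le⟩
      fun z hz => huc ⟨hz.1, hz.2.trans_lt hdu⟩⟩
    exact absurd (le_sSup this) (not_le.mpr hd1)

/-- The integral is unique. -/
theorem HasHKIntegral.unique {a b : EReal} (hab : a ≤ b) {f : ℝ → ℝ} {L L' : ℝ}
    (h : HasHKIntegral a b f L) (h' : HasHKIntegral a b f L') : L = L' := by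
  by_contra hne
  have hpos : 0 < |L - L'| / 2 := by
    have := abs_pos.mpr (sub_ne_zero.mpr hne); linarith
  obtain ⟨γ, hγ, H⟩ := h _ hpos
  obtain ⟨γ', hγ', H'⟩ := h' _ hpos
  obtain ⟨D, hD⟩ := HKDivision.exists_isFine hab (γ := fun x => γ x ∩ γ' x)
    fun x => ⟨inter_mem (hγ x).1 (hγ' x).1, fun hx hm => (hγ x).2.1 hx hm.1,
      fun hx hm => (hγ x).2.2 hx hm.1⟩
  have h1 := H D fun i hi => (hD i hi).trans inter_subset_left
  have h2 := H' D fun i hi => (hD i hi).trans inter_subset_right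
  have h3 := abs_sub_le L (D.riemannSum f) L'
  rw [abs_sub_comm] at h1
  linarith

/-- The integral of an integrable function is its Henstock--Kurzweil integral. -/
theorem HasHKIntegral.hkIntegral_eq {a b : EReal} (hab : a ≤ b) {f : ℝ → ℝ} {L : ℝ}
    (h : HasHKIntegral a b f L) : hkIntegral a b f = L := by
  have hi : HKIntegrable a b f := ⟨L, h⟩
  rw [hkIntegral, dif_pos hi]
  exact hi.choose_spec.unique hab h

/-! Integrability is handled through variational primitives (`IsPrim`): for each ε a monotone P with
values in [0, ε] dominates |f(t)(v - u) - (F v - F u)| by P v - P u for all u ≤ t ≤ v near t.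
Henstock's lemma (`HKIntegrable.exists_isPrim`) and summation along fine divisions
(`IsPrim.hasHKIntegral`) make this equivalent to integrability. The condition is local at the tag
and the functions P can be added, so primitives may be assembled over countably many sets of tags.

Necessity. Write k n = gn n - g. The Alexiewicz norm is not complete, so a sliding hump replaces
Banach-Steinhaus: if the multipliers k n were not uniformly bounded near some point, humps on
disjoint intervals shrinking to it would add up to an integrable f with unbounded products
(`exists_uniform_multiplier_bound`). Testing a bounded multiplier against differences of normalised
indicators of short intervals bounds the variation of its averages; these converge to it almost
everywhere, because an integrable function is a.e. the symmetric derivative of its primitive. So gn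
n has bounded variation off a null set, and one-sided limits normalise it. For f the indicator of a
compact interval, small integrals together with bounded variation force small measure
(`volume_abs_ge_le_of_hkIntegral_le`).

Sufficiency. Integration by parts bounds the integral of f k over [u, v], less k(v)(F v - F u), by
3ω times the variation of k there, where ω bounds |F - F u| on [u, v]
(`IsPrim.mul_boundedVariationOn`). Cut [a, b] into finitely many pieces on which F oscillates by at
most ω. Convergence in measure gives each piece a point where k n is small, so there |k n| is at
most a small number plus its variation on the piece. Summed up, all integrals are at most 4ω times
the total variation plus a small error (`tendsto_uniform_of_isPrim_mul`). -/

/-! ### Riemann sums of fine divisions, in inductive form -/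

open Classical in
/-- The extension of `f : ℝ → ℝ` to the extended real line by `0` at `±∞`. -/
noncomputable def fext (f : ℝ → ℝ) (t : EReal) : ℝ :=
  if t = ⊥ ∨ t = ⊤ then 0 else f t.toReal

theorem fext_coe (f : ℝ → ℝ) (x : ℝ) : fext f x = f x := by simp [fext]

theorem fext_bot (f : ℝ → ℝ) : fext f ⊥ = 0 := by simp [fext]

theorem fext_top (f : ℝ → ℝ) : fext f ⊤ = 0 := by simp [fext]

theorem HKDivision.riemannSum_eq {a b : EReal} (D : HKDivision a b) (f : ℝ → ℝ) :
    D.riemannSum f = ∑ i ∈ Finset.range D.n,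
      fext f (D.tag i) * ((D.pt (i + 1)).toReal - (D.pt i).toReal) := by
  unfold HKDivision.riemannSum fext
  refine Finset.sum_congr rfl fun i _ => ?_
  split_ifs <;> simp_all

/-- `FineSum f γ u v r`: some `γ`-fine division of `[u, v]` has Riemann sum `r`. -/
inductive FineSum (f : ℝ → ℝ) (γ : EReal → Set EReal) (u : EReal) : EReal → ℝ → Prop
  | nil : FineSum f γ u u 0
  | snoc {v w t : EReal} {r : ℝ} : FineSum f γ u v r → v ≤ t → t ≤ w → Icc v w ⊆ γ t →
      FineSum f γ u w (r + fext f t * (w.toReal - v.toReal))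

theorem FineSum.le {f : ℝ → ℝ} {γ : EReal → Set EReal} {u v : EReal} {r : ℝ}
    (h : FineSum f γ u v r) : u ≤ v := by
  induction h with
  | nil => exact le_rfl
  | snoc _ h1 h2 _ ih => exact ih.trans (h1.trans h2)

theorem FineSum.append {f : ℝ → ℝ} {γ : EReal → Set EReal} {u v w : EReal} {r s : ℝ}
    (h : FineSum f γ u v r) (h' : FineSum f γ v w s) : FineSum f γ u w (r + s) := by
  induction h' with
  | nil => simpa using h
  | snoc _ h1 h2 h3 ih => rw [← add_assoc]; exact ih.snoc h1 h2 h3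

theorem FineSum.mono {f : ℝ → ℝ} {γ γ' : EReal → Set EReal} (hγ : ∀ t, γ t ⊆ γ' t)
    {u v : EReal} {r : ℝ} (h : FineSum f γ u v r) : FineSum f γ' u v r := by
  induction h with
  | nil => exact .nil
  | snoc _ h1 h2 h3 ih => exact ih.snoc h1 h2 (h3.trans (hγ _))

theorem HKDivision.fineSum {a b : EReal} (D : HKDivision a b) (f : ℝ → ℝ)
    {γ : EReal → Set EReal} (hD : D.IsFine γ) : FineSum f γ a b (D.riemannSum f) := by
  have key : ∀ m ≤ D.n, FineSum f γ a (D.pt m) (∑ i ∈ Finset.range m,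
      fext f (D.tag i) * ((D.pt (i + 1)).toReal - (D.pt i).toReal)) := by
    intro m
    induction m with
    | zero => intro _; rw [D.pt_zero]; simpa using FineSum.nil
    | succ m ih =>
      intro hm
      rw [Finset.sum_range_succ]
      exact (ih (by omega)).snoc (D.tag_mem m hm).1 (D.tag_mem m hm).2 (hD m hm)
  have := key D.n le_rfl
  rwa [D.pt_last, ← D.riemannSum_eq] at this

theorem FineSum.exists_division {f : ℝ → ℝ} {γ : EReal → Set EReal} {a b : EReal} {r : ℝ}
    (h : FineSum f γ a b r) : ∃ D : HKDivision a b, D.IsFine γ ∧ D.riemannSum f = r := by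
  induction h with
  | nil =>
    exact ⟨⟨0, fun _ => a, fun _ => a, rfl, rfl, by simp⟩, by intro i hi; simp at hi,
      by simp [HKDivision.riemannSum]⟩
  | @snoc v w t r _ h1 h2 h3 ih =>
    obtain ⟨D, hD, rfl⟩ := ih
    refine ⟨⟨D.n + 1, fun i => if i ≤ D.n then D.pt i else w,
      fun i => if i < D.n then D.tag i else t, by simp [D.pt_zero], by simp, ?_⟩, ?_, ?_⟩
    · intro i hi
      rcases Nat.lt_succ_iff_lt_or_eq.mp hi with h | h
      · simpa [h, h.le, Nat.succ_le_of_lt h] using D.tag_mem i h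
      · subst h; simpa [D.pt_last] using ⟨h1, h2⟩
    · intro i hi
      rcases Nat.lt_succ_iff_lt_or_eq.mp hi with h | h
      · simpa [h, h.le, Nat.succ_le_of_lt h] using hD i h
      · subst h; simpa [D.pt_last] using h3
    · rw [HKDivision.riemannSum_eq, HKDivision.riemannSum_eq, Finset.sum_range_succ]
      congr 1
      · refine Finset.sum_congr rfl fun i hi => ?_
        have hi := Finset.mem_range.mp hi
        simp [hi, hi.le, Nat.succ_le_of_lt hi]
      · simp [D.pt_last]

theorem exists_fineSum (f : ℝ → ℝ) {γ : EReal → Set EReal} (hγ : IsHKGauge γ) {u v : EReal}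
    (huv : u ≤ v) : ∃ r, FineSum f γ u v r :=
  let ⟨D, hD⟩ := HKDivision.exists_isFine huv hγ
  ⟨_, D.fineSum f hD⟩

theorem IsHKGauge.inter {γ γ' : EReal → Set EReal} (h : IsHKGauge γ) (h' : IsHKGauge γ') :
    IsHKGauge fun t => γ t ∩ γ' t := fun x =>
  ⟨inter_mem (h x).1 (h' x).1, fun hx hm => (h x).2.1 hx hm.1, fun hx hm => (h x).2.2 hx hm.1⟩

/-- Deleting ±∞ from the sets of other tags leaves neighbourhoods. Hence any choice of
neighbourhoods admits a fine division, which serves below as a compactness principle. -/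
theorem exists_gauge_subset {U : EReal → Set EReal} (hU : ∀ t, U t ∈ 𝓝 t) :
    ∃ γ, IsHKGauge γ ∧ ∀ t, γ t ⊆ U t := by
  refine ⟨fun t => U t ∩ {x | (t ≠ ⊥ → x ≠ ⊥) ∧ (t ≠ ⊤ → x ≠ ⊤)}, fun t =>
    ⟨inter_mem (hU t) (inter_mem ?_ ?_), fun ht hm => hm.2.1 ht rfl, fun ht hm => hm.2.2 ht rfl⟩,
    fun t => inter_subset_left⟩
  · by_cases ht : t = ⊥
    · exact Filter.univ_mem' fun x h => absurd ht h
    · filter_upwards [isOpen_ne.mem_nhds ht] with x hx _ using hx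
  · by_cases ht : t = ⊤
    · exact Filter.univ_mem' fun x h => absurd ht h
    · filter_upwards [isOpen_ne.mem_nhds ht] with x hx _ using hx

/-! ### Variational primitives and Henstock's lemma -/

/-- `F` is a variational primitive of `f` on `[a, b]` with respect to tags in `E`. -/
def IsPrimOn (a b : EReal) (f : ℝ → ℝ) (F : EReal → ℝ) (E : Set EReal) : Prop :=
  ∀ ε : ℝ, 0 < ε → ∃ P : EReal → ℝ, Monotone P ∧ (∀ x, 0 ≤ P x ∧ P x ≤ ε) ∧
    ∀ t ∈ E, ∀ᶠ p in 𝓝[Icc a t] t ×ˢ 𝓝[Icc t b] t,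
      |fext f t * (p.2.toReal - p.1.toReal) - (F p.2 - F p.1)| ≤ P p.2 - P p.1

/-- `F` is a primitive of the Henstock--Kurzweil integrable function `f` on `[a, b]`. -/
def IsPrim (a b : EReal) (f : ℝ → ℝ) (F : EReal → ℝ) : Prop := IsPrimOn a b f F univ

/-- The defect bounds telescope along a fine division, so the total error is at most P b - P a ≤ ε /
2. -/
theorem IsPrim.hasHKIntegral {a b : EReal} {f : ℝ → ℝ} {F : EReal → ℝ}
    (h : IsPrim a b f F) : HasHKIntegral a b f (F b - F a) := by
  intro ε hε
  obtain ⟨P, hP, hPb, H⟩ := h (ε / 2) (by positivity)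
  have : ∀ t, ∃ W ∈ 𝓝 t, ∀ u ∈ W, ∀ v ∈ W, u ∈ Icc a t → v ∈ Icc t b →
      |fext f t * (v.toReal - u.toReal) - (F v - F u)| ≤ P v - P u := by
    intro t
    obtain ⟨A, hA, B, hB, hAB⟩ := Filter.mem_prod_iff.mp (H t (mem_univ t))
    obtain ⟨A', hA', hA''⟩ := mem_nhdsWithin_iff_exists_mem_nhds_inter.mp hA
    obtain ⟨B', hB', hB''⟩ := mem_nhdsWithin_iff_exists_mem_nhds_inter.mp hB
    exact ⟨A' ∩ B', inter_mem hA' hB', fun u hu v hv hut hvt =>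
      hAB (mk_mem_prod (hA'' ⟨hu.1, hut⟩) (hB'' ⟨hv.2, hvt⟩))⟩
  choose W hW hWin using this
  obtain ⟨γ, hγ, hγW⟩ := exists_gauge_subset hW
  refine ⟨γ, hγ, fun D hD => ?_⟩
  have key : ∀ v r, FineSum f γ a v r → v ≤ b → |r - (F v - F a)| ≤ P v - P a := by
    intro v r hr
    induction hr with
    | nil => simp
    | @snoc v w t r h0 h1 h2 h3 ih =>
      intro hw
      have i1 := ih (h1.trans (h2.trans hw))
      have i2 := hWin t v (hγW t (h3 ⟨le_rfl, h1.trans h2⟩)) w (hγW t (h3 ⟨h1.trans h2, le_rfl⟩))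
        ⟨h0.le, h1⟩ ⟨h2, hw⟩
      rw [abs_le] at *
      constructor <;> linarith
  have h1 := key b _ (D.fineSum f hD) le_rfl
  have := (hPb b).2
  have := (hPb a).1
  linarith

/-- Henstock's lemma: the majorant P at x is the spread, supremum minus infimum, of the fine Riemann
sums over [a, x]. -/
theorem HKIntegrable.exists_isPrim {a b : EReal} (hab : a ≤ b) {f : ℝ → ℝ}
    (h : HKIntegrable a b f) : ∃ F, IsPrim a b f F := by
  obtain ⟨L, hL⟩ := h
  have hL' : ∀ ε : ℝ, 0 < ε → ∃ γ, IsHKGauge γ ∧ ∀ r, FineSum f γ a b r → |r - L| < ε := by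
    intro ε hε
    obtain ⟨γ, hγ, H⟩ := hL ε hε
    refine ⟨γ, hγ, fun r hr => ?_⟩
    obtain ⟨D, hD, rfl⟩ := hr.exists_division
    exact H D hD
  choose! γ hγ Hγ using hL'
  -- Both sums are completed by the same sum over [x, b], and both totals are within ε of L.
  have hdiam : ∀ ε > 0, ∀ x ∈ Icc a b, ∀ r s, FineSum f (γ ε) a x r → FineSum f (γ ε) a x s →
      r ≤ s + 2 * ε := by
    intro ε hε x hx r s hr hs
    obtain ⟨q, hq⟩ := exists_fineSum f (hγ ε hε) hx.2
    have h1 := Hγ ε hε _ (hr.append hq)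
    have h2 := Hγ ε hε _ (hs.append hq)
    rw [abs_lt] at h1 h2
    linarith
  have hF : ∀ x, ∃ y : ℝ, x ∈ Icc a b → ∀ ε > 0, ∀ r, FineSum f (γ ε) a x r →
      |r - y| ≤ 4 * ε := by
    intro x
    by_cases hx : x ∈ Icc a b
    -- F x is the supremum of s - 2ε over all ε and all `γ ε`-fine sums s; by `hcross` each of these
    -- lies below every s' + 2δ.
    · refine ⟨sSup {r | ∃ ε > 0, FineSum f (γ ε) a x (r + 2 * ε)}, fun _ => ?_⟩
      have hcross : ∀ ε > 0, ∀ δ > 0, ∀ r s, FineSum f (γ ε) a x r → FineSum f (γ δ) a x s →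
          r ≤ s + 2 * ε + 2 * δ := by
        intro ε hε δ hδ r s hr hs
        obtain ⟨q, hq⟩ := exists_fineSum f ((hγ ε hε).inter (hγ δ hδ)) hx.1
        have h1 := hdiam ε hε x hx r q hr (hq.mono fun t => inter_subset_left)
        have h2 := hdiam δ hδ x hx q s (hq.mono fun t => inter_subset_right) hs
        linarith
      intro ε hε r hr
      have hup : ∀ q ∈ {r | ∃ ε > 0, FineSum f (γ ε) a x (r + 2 * ε)}, q ≤ r + 2 * ε := by
        rintro q ⟨δ, hδ, hq⟩
        have := hcross δ hδ ε hε _ _ hq hr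
        linarith
      have hmem : r - 2 * ε ∈ {r | ∃ ε > 0, FineSum f (γ ε) a x (r + 2 * ε)} :=
        ⟨ε, hε, by simpa using hr⟩
      have h1 := csSup_le ⟨_, hmem⟩ hup
      have h2 := le_csSup ⟨_, hup⟩ hmem
      rw [abs_le]; constructor <;> linarith
    · exact ⟨0, fun h => absurd h hx⟩
  choose F hF using hF
  refine ⟨F, fun ε hε => ?_⟩
  -- The sums over [a, x] lie within 4δ of F x, so their spread is at most 8δ.
  obtain ⟨δ, hδ, hδε⟩ : ∃ δ : ℝ, 0 < δ ∧ 8 * δ ≤ ε := ⟨ε / 8, by positivity, by linarith⟩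
  set S : EReal → Set ℝ := fun x => {r | FineSum f (γ δ) a x r} with hS
  have hne : ∀ x ∈ Icc a b, (S x).Nonempty := fun x hx => exists_fineSum f (hγ δ hδ) hx.1
  have hba : ∀ x ∈ Icc a b, F x + 4 * δ ∈ upperBounds (S x) := by
    intro x hx r hr
    have := abs_le.mp (hF x hx δ hδ r hr); linarith
  have hbb : ∀ x ∈ Icc a b, F x - 4 * δ ∈ lowerBounds (S x) := by
    intro x hx r hr
    have := abs_le.mp (hF x hx δ hδ r hr); linarith
  set Q : EReal → ℝ := fun x => sSup (S x) - sInf (S x) with hQ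
  have step : ∀ u ∈ Icc a b, ∀ v ∈ Icc a b, ∀ q, FineSum f (γ δ) u v q →
      sSup (S u) + q ≤ sSup (S v) ∧ sInf (S v) ≤ sInf (S u) + q := by
    intro u hu v hv q hq
    constructor
    · rw [← le_sub_iff_add_le]
      refine csSup_le (hne u hu) fun r hr => ?_
      have : r + q ≤ sSup (S v) := le_csSup ⟨_, hba v hv⟩ (hr.append hq)
      linarith
    · rw [← sub_le_iff_le_add]
      refine le_csInf (hne u hu) fun r hr => ?_
      have : sInf (S v) ≤ r + q := csInf_le ⟨_, hbb v hv⟩ (hr.append hq)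
      linarith
  have stepF : ∀ u ∈ Icc a b, ∀ v ∈ Icc a b, u ≤ v →
      F v - F u ≤ sSup (S v) - sSup (S u) ∧ sInf (S v) - sInf (S u) ≤ F v - F u := by
    intro u hu v hv huv
    -- A sum over [u, v] fine for both gauges approximates F v - F u within η and obeys `step`.
    have : ∀ η > 0, F v - F u ≤ sSup (S v) - sSup (S u) + η ∧
        sInf (S v) - sInf (S u) ≤ F v - F u + η := by
      intro η hη
      have hη' : 0 < η / 8 := by positivity
      obtain ⟨r, hr⟩ := exists_fineSum f (hγ _ hη') hu.1
      obtain ⟨q, hq⟩ := exists_fineSum f ((hγ _ hη').inter (hγ δ hδ)) huv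
      have h1 := step u hu v hv q (hq.mono fun t => inter_subset_right)
      have h2 := abs_le.mp (hF u hu _ hη' r hr)
      have h3 := abs_le.mp (hF v hv _ hη' _ (hr.append (hq.mono fun t => inter_subset_left)))
      constructor <;> linarith
    exact ⟨le_of_forall_pos_le_add fun η hη => (this η hη).1,
      le_of_forall_pos_le_add fun η hη => (this η hη).2⟩
  have hclamp : ∀ x, max a (min x b) ∈ Icc a b := fun x =>
    ⟨le_max_left _ _, max_le hab (min_le_right _ _)⟩
  have hclampmono : Monotone fun x : EReal => max a (min x b) := fun x y hxy =>
    max_le_max le_rfl (min_le_min hxy le_rfl)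
  refine ⟨fun x => Q (max a (min x b)), ?_, ?_, ?_⟩
  · intro x y hxy
    have := stepF _ (hclamp x) _ (hclamp y) (hclampmono hxy)
    simp only [hQ]
    linarith
  · intro x
    obtain ⟨r, hr⟩ := hne _ (hclamp x)
    have h1 := le_csSup ⟨_, hba _ (hclamp x)⟩ hr
    have h2 := csInf_le ⟨_, hbb _ (hclamp x)⟩ hr
    have h3 := csSup_le ⟨_, hr⟩ (hba _ (hclamp x))
    have h4 := le_csInf ⟨_, hr⟩ (hbb _ (hclamp x))
    simp only [hQ]
    constructor <;> linarith
  · intro t _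
    have hIcc : ∀ᶠ p : EReal × EReal in 𝓝 t ×ˢ 𝓝 t, Icc p.1 p.2 ⊆ γ δ t :=
      ((Filter.tendsto_fst.Icc Filter.tendsto_snd).eventually
        (Filter.eventually_smallSets_subset.2 (hγ δ hδ t).1))
    have hmem : ∀ᶠ p : EReal × EReal in 𝓝[Icc a t] t ×ˢ 𝓝[Icc t b] t,
        p.1 ∈ Icc a t ∧ p.2 ∈ Icc t b :=
      (eventually_mem_nhdsWithin).prod_mk (eventually_mem_nhdsWithin)
    filter_upwards [hIcc.filter_mono (Filter.prod_mono nhdsWithin_le_nhds nhdsWithin_le_nhds),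
      hmem] with p hp hp'
    obtain ⟨⟨h1, h2⟩, h3, h4⟩ := hp'
    have hu : p.1 ∈ Icc a b := ⟨h1, h2.trans (h3.trans h4)⟩
    have hv : p.2 ∈ Icc a b := ⟨h1.trans (h2.trans h3), h4⟩
    have e1 : max a (min p.1 b) = p.1 := by rw [min_eq_left hu.2, max_eq_right hu.1]
    have e2 : max a (min p.2 b) = p.2 := by rw [min_eq_left hv.2, max_eq_right hv.1]
    -- The single interval with tag t is itself a fine division. Its sum and F v - F u both lie
    -- between the increments of infimum and supremum, so they differ by at most Q v - Q u.
    have s1 := step _ hu _ hv _ (by simpa using (FineSum.nil (u := p.1)).snoc h2 h3 hp)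
    have s2 := stepF _ hu _ hv (h2.trans h3)
    simp only [e1, e2, hQ]
    rw [abs_le]
    constructor <;> linarith

/-! ### Locality and gluing of primitives -/

theorem eventually_mem_prod_nhdsWithin_Icc (a b t : EReal) :
    ∀ᶠ p : EReal × EReal in 𝓝[Icc a t] t ×ˢ 𝓝[Icc t b] t, p.1 ∈ Icc a t ∧ p.2 ∈ Icc t b :=
  (eventually_mem_nhdsWithin).prod_mk (eventually_mem_nhdsWithin)

/-- Tags outside [a, b] impose no condition. -/
theorem prod_nhdsWithin_Icc_eq_bot {a b t : EReal} (ht : t ∉ Icc a b) :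
    𝓝[Icc a t] t ×ˢ 𝓝[Icc t b] t = ⊥ := by
  by_cases h : a ≤ t
  · have : Icc t b = ∅ := Icc_eq_empty fun h' => ht ⟨h, h'⟩
    simp [this]
  · have : Icc a t = ∅ := Icc_eq_empty h
    simp [this]

theorem IsPrimOn.mono {a b : EReal} {f : ℝ → ℝ} {F : EReal → ℝ} {E E' : Set EReal}
    (h : IsPrimOn a b f F E) (hE : E' ⊆ E) : IsPrimOn a b f F E' := by
  intro ε hε
  obtain ⟨P, hP, hPb, H⟩ := h ε hε
  exact ⟨P, hP, hPb, fun t ht => H t (hE ht)⟩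

/-- Take majorants bounded by ε / 2 / 2 ^ i and add them; at a tag of `E i` the other increments are
nonnegative and only help. -/
theorem IsPrimOn.iUnion {a b : EReal} {f : ℝ → ℝ} {F : EReal → ℝ} {E : ℕ → Set EReal}
    (h : ∀ i, IsPrimOn a b f F (E i)) : IsPrimOn a b f F (⋃ i, E i) := by
  intro ε hε
  have hpos : ∀ i : ℕ, 0 < ε / 2 / 2 ^ i := fun i => by positivity
  choose P hP hPb H using fun i => h i _ (hpos i)
  have hsum : ∀ x, Summable fun i => P i x := fun x =>
    Summable.of_nonneg_of_le (fun i => (hPb i x).1) (fun i => (hPb i x).2)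
      (summable_geometric_two' ε)
  refine ⟨fun x => ∑' i, P i x, ?_, ?_, ?_⟩
  · intro x y hxy
    exact (hsum x).tsum_le_tsum (fun i => hP i hxy) (hsum y)
  · intro x
    refine ⟨tsum_nonneg fun i => (hPb i x).1, ?_⟩
    have := (hsum x).tsum_le_tsum (fun i => (hPb i x).2) (summable_geometric_two' ε)
    rwa [tsum_geometric_two'] at this
  · intro t ht
    obtain ⟨i, hi⟩ := mem_iUnion.mp ht
    filter_upwards [H i t hi, eventually_mem_prod_nhdsWithin_Icc a b t] with p hp hm
    refine hp.trans ?_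
    rw [← (hsum _).tsum_sub (hsum _)]
    exact ((hsum p.2).sub (hsum p.1)).le_tsum i
      fun j _ => sub_nonneg.mpr (hP j (hm.1.2.trans hm.2.1))

theorem IsPrimOn.union {a b : EReal} {f : ℝ → ℝ} {F : EReal → ℝ} {E E' : Set EReal}
    (h : IsPrimOn a b f F E) (h' : IsPrimOn a b f F E') : IsPrimOn a b f F (E ∪ E') := by
  refine (IsPrimOn.iUnion (E := fun i : ℕ => if i = 0 then E else E') fun i => ?_).mono ?_
  · by_cases hi : i = 0 <;> simpa [hi]
  · rintro t (ht | ht)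
    · exact mem_iUnion.mpr ⟨0, by simpa⟩
    · exact mem_iUnion.mpr ⟨1, by simpa⟩

theorem IsPrimOn.add {a b : EReal} {f f' : ℝ → ℝ} {F F' : EReal → ℝ} {E : Set EReal}
    (h : IsPrimOn a b f F E) (h' : IsPrimOn a b f' F' E) :
    IsPrimOn a b (fun x => f x + f' x) (fun x => F x + F' x) E := by
  intro ε hε
  obtain ⟨P, hP, hPb, H⟩ := h (ε / 2) (by positivity)
  obtain ⟨P', hP', hPb', H'⟩ := h' (ε / 2) (by positivity)
  refine ⟨fun x => P x + P' x, hP.add hP', fun x => ?_, fun t ht => ?_⟩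
  · have := hPb x; have := hPb' x; constructor <;> linarith
  · filter_upwards [H t ht, H' t ht] with p h1 h2
    have : fext (fun x => f x + f' x) t = fext f t + fext f' t := by
      unfold fext; split_ifs <;> simp
    rw [this, add_mul]
    rw [abs_le] at *
    constructor <;> linarith

theorem IsPrimOn.const_mul {a b : EReal} {f : ℝ → ℝ} {F : EReal → ℝ} {E : Set EReal} (c : ℝ)
    (h : IsPrimOn a b f F E) : IsPrimOn a b (fun x => c * f x) (fun x => c * F x) E := by
  intro ε hε
  have hc : 0 < |c| + 1 := by positivity
  obtain ⟨P, hP, hPb, H⟩ := h (ε / (|c| + 1)) (by positivity)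
  refine ⟨fun x => (|c| + 1) * P x, hP.const_mul hc.le, fun x => ⟨?_, ?_⟩, fun t ht => ?_⟩
  · have := (hPb x).1; positivity
  · have := (hPb x).2; rw [le_div_iff₀ hc] at this; linarith
  · filter_upwards [H t ht] with p h1
    have : fext (fun x => c * f x) t = c * fext f t := by
      unfold fext; split_ifs <;> simp
    rw [this]
    calc _ = |c| * |fext f t * (p.2.toReal - p.1.toReal) - (F p.2 - F p.1)| := by
          rw [← abs_mul]; ring_nf
      _ ≤ (|c| + 1) * (P p.2 - P p.1) := by
          refine mul_le_mul (by linarith) h1 (abs_nonneg _) hc.le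
      _ = _ := by ring

theorem IsPrimOn.sum {a b : EReal} {ι : Type*} (s : Finset ι) {f : ι → ℝ → ℝ}
    {F : ι → EReal → ℝ} {E : Set EReal} (h : ∀ i ∈ s, IsPrimOn a b (f i) (F i) E) :
    IsPrimOn a b (fun x => ∑ i ∈ s, f i x) (fun x => ∑ i ∈ s, F i x) E := by
  classical
  induction s using Finset.induction_on with
  | empty =>
    intro ε hε
    refine ⟨fun _ => 0, monotone_const, fun _ => ⟨le_rfl, hε.le⟩, fun t _ => ?_⟩
    refine Eventually.of_forall fun p => ?_
    have : fext (fun _ => 0) t = 0 := by unfold fext; split_ifs <;> rfl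
    simp [this]
  | insert i s hi ih =>
    simp only [Finset.sum_insert hi]
    exact (h i (Finset.mem_insert_self _ _)).add
      (ih fun j hj => h j (Finset.mem_insert_of_mem hj))

/-- The condition at t sees only f(t) and the values of F near t up to an additive constant. -/
theorem IsPrimOn.of_locally_eq {a b a' b' : EReal} {f f' : ℝ → ℝ} {F F' : EReal → ℝ}
    {E E' : Set EReal} (h : IsPrimOn a b f F E)
    (h' : ∀ t ∈ E', t ∈ Icc a' b' → t ∈ E ∧ fext f' t = fext f t ∧
      ∀ᶠ x in 𝓝[Icc a' b'] t, x ∈ Icc a b ∧ F' x - F x = F' t - F t) :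
    IsPrimOn a' b' f' F' E' := by
  intro ε hε
  obtain ⟨P, hP, hPb, H⟩ := h ε hε
  refine ⟨P, hP, hPb, fun t ht => ?_⟩
  by_cases htm : t ∈ Icc a' b'
  · obtain ⟨hE, hf, hev⟩ := h' t ht htm
    have hl : ∀ᶠ x in 𝓝[Icc a' t] t, x ∈ Icc a b ∧ F' x - F x = F' t - F t :=
      hev.filter_mono (nhdsWithin_mono _ (Icc_subset_Icc_right htm.2))
    have hr : ∀ᶠ x in 𝓝[Icc t b'] t, x ∈ Icc a b ∧ F' x - F x = F' t - F t :=
      hev.filter_mono (nhdsWithin_mono _ (Icc_subset_Icc_left htm.1))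
    have hle : 𝓝[Icc a' t] t ×ˢ 𝓝[Icc t b'] t ≤ 𝓝[Icc a t] t ×ˢ 𝓝[Icc t b] t := by
      refine Filter.prod_mono (le_inf nhdsWithin_le_nhds ?_) (le_inf nhdsWithin_le_nhds ?_)
      · rw [le_principal_iff]
        filter_upwards [hl, self_mem_nhdsWithin] with x hx hx' using ⟨hx.1.1, hx'.2⟩
      · rw [le_principal_iff]
        filter_upwards [hr, self_mem_nhdsWithin] with x hx hx' using ⟨hx'.1, hx.1.2⟩
    filter_upwards [(H t hE).filter_mono hle, hl.prod_mk hr] with p hp hq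
    have e : F' p.2 - F' p.1 = F p.2 - F p.1 := by linarith [hq.1.2, hq.2.2]
    rwa [hf, e]
  · simp [prod_nhdsWithin_Icc_eq_bot htm]

theorem IsPrim.mono_interval {a b c d : EReal} {f : ℝ → ℝ} {F : EReal → ℝ} (h : IsPrim a b f F)
    (hac : a ≤ c) (hdb : d ≤ b) : IsPrim c d f F :=
  IsPrimOn.of_locally_eq h fun t _ _ => ⟨mem_univ t, rfl, by
    filter_upwards [self_mem_nhdsWithin] with x hx
    exact ⟨⟨hac.trans hx.1, hx.2.trans hdb⟩, by ring⟩⟩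

theorem tendsto_fext_mul_sub (f : ℝ → ℝ) (t : EReal) :
    Tendsto (fun p : EReal × EReal => fext f t * (p.2.toReal - p.1.toReal))
      (𝓝 t ×ˢ 𝓝 t) (𝓝 0) := by
  by_cases ht : t = ⊥ ∨ t = ⊤
  · have : fext f t = 0 := if_pos ht
    simp [this]
  · have h1 : Tendsto EReal.toReal (𝓝 t) (𝓝 t.toReal) :=
      EReal.tendsto_toReal (fun h => ht (.inr h)) (fun h => ht (.inl h))
    have := ((h1.comp tendsto_snd).sub (h1.comp (tendsto_fst (f := 𝓝 t) (g := 𝓝 t)))).const_mul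
      (fext f t)
    simpa using this

/-- A majorant jumping by ε / 2 on either side of t absorbs the defect at t, which tends to 0 by
continuity. Exceptional points, ±∞ included, therefore cost nothing but continuity of F. -/
theorem isPrimOn_singleton {a b : EReal} (f : ℝ → ℝ) {F : EReal → ℝ} {t : EReal}
    (h : ContinuousWithinAt F (Icc a b) t) : IsPrimOn a b f F {t} := by
  classical
  intro ε hε
  refine ⟨fun x => if x < t then 0 else if x = t then ε / 2 else ε, ?_, ?_, ?_⟩
  · intro x y hxy
    by_cases h1 : x < t
    · simp only [h1, if_true]; split_ifs <;> linarith
    · have h2 : ¬ y < t := fun h' => h1 (hxy.trans_lt h')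
      simp only [h1, h2, if_false]
      split_ifs with h3 h4 h4
      · rfl
      · linarith
      · exact absurd (le_antisymm (h4 ▸ hxy) (not_lt.mp h1)) h3
      · rfl
  · intro x; dsimp only; split_ifs <;> constructor <;> linarith
  · rintro s rfl
    by_cases htm : s ∈ Icc a b
    · have hl : Tendsto F (𝓝[Icc a s] s) (𝓝 (F s)) :=
        h.mono_left (nhdsWithin_mono _ (Icc_subset_Icc_right htm.2))
      have hr : Tendsto F (𝓝[Icc s b] s) (𝓝 (F s)) :=
        h.mono_left (nhdsWithin_mono _ (Icc_subset_Icc_left htm.1))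
      have h1 : Tendsto (fun p : EReal × EReal =>
          fext f s * (p.2.toReal - p.1.toReal) - (F p.2 - F p.1))
          (𝓝[Icc a s] s ×ˢ 𝓝[Icc s b] s) (𝓝 0) := by
        have := ((tendsto_fext_mul_sub f s).mono_left (Filter.prod_mono
          (nhdsWithin_le_nhds (s := Icc a s)) (nhdsWithin_le_nhds (s := Icc s b)))).sub
          ((hr.comp tendsto_snd).sub (hl.comp tendsto_fst))
        simpa using this
      have h2 := (tendsto_order.mp (tendsto_zero_iff_abs_tendsto_zero _ |>.mp h1)).2 (ε / 2)
        (by positivity)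
      filter_upwards [h2, eventually_mem_prod_nhdsWithin_Icc a b s] with p hp hm
      simp only [Function.comp_apply] at hp
      obtain ⟨⟨-, h3⟩, h4, -⟩ := hm
      rcases h3.eq_or_lt with h5 | h5 <;> rcases h4.eq_or_lt with h6 | h6
      · rw [← h6, h5]; simp
      · simp only [h5, lt_irrefl, not_lt.mpr h4, h6.ne', if_true, if_false]; rw [h5] at hp; linarith
      · simp only [← h6, lt_irrefl, h5, if_true, if_false]; rw [← h6] at hp; linarith
      · simp only [h5, not_lt.mpr h4, h6.ne', if_true, if_false]; linarith
    · simp [prod_nhdsWithin_Icc_eq_bot htm]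

theorem IsPrim.continuousOn {a b : EReal} {f : ℝ → ℝ} {F : EReal → ℝ} (h : IsPrim a b f F) :
    ContinuousOn F (Icc a b) := by
  intro t ht
  have key : ∀ ε > 0, (∀ᶠ v in 𝓝[Icc t b] t, |F v - F t| < ε) ∧
      ∀ᶠ u in 𝓝[Icc a t] t, |F u - F t| < ε := by
    intro ε hε
    obtain ⟨P, hP, hPb, H⟩ := h (ε / 2) (by positivity)
    have h1 := H t (mem_univ t)
    have h2 := (tendsto_order.mp (tendsto_zero_iff_abs_tendsto_zero _ |>.mp
      ((tendsto_fext_mul_sub f t).mono_left (Filter.prod_mono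
          (nhdsWithin_le_nhds (s := Icc a t)) (nhdsWithin_le_nhds (s := Icc t b)))))).2 (ε / 2)
        (by positivity)
    have h3 : ∀ᶠ p in 𝓝[Icc a t] t ×ˢ 𝓝[Icc t b] t, |F p.2 - F p.1| < ε := by
      filter_upwards [h1, h2] with p hp hq
      simp only [Function.comp_apply] at hq
      have := (hPb p.1).1
      have := (hPb p.2).2
      rw [abs_lt] at *
      rw [abs_le] at hp
      constructor <;> linarith
    constructor
    · have : Tendsto (fun v => (t, v)) (𝓝[Icc t b] t) (𝓝[Icc a t] t ×ˢ 𝓝[Icc t b] t) :=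
        Tendsto.prodMk (tendsto_const_pure.mono_right (pure_le_nhdsWithin ⟨ht.1, le_rfl⟩))
          tendsto_id
      exact this.eventually h3
    · have : Tendsto (fun u => (u, t)) (𝓝[Icc a t] t) (𝓝[Icc a t] t ×ˢ 𝓝[Icc t b] t) :=
        Tendsto.prodMk tendsto_id
          (tendsto_const_pure.mono_right (pure_le_nhdsWithin ⟨le_rfl, ht.2⟩))
      filter_upwards [this.eventually h3] with u hu
      rwa [abs_sub_comm]
  unfold ContinuousWithinAt
  rw [← Icc_union_Icc_eq_Icc ht.1 ht.2, nhdsWithin_union, Metric.tendsto_nhds]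
  intro ε hε
  simp only [Real.dist_eq]
  exact eventually_sup.mpr ⟨(key ε hε).2, (key ε hε).1⟩

theorem IsPrim.continuous_clamp {c d : EReal} (hcd : c ≤ d) {f : ℝ → ℝ} {F : EReal → ℝ}
    (h : IsPrim c d f F) : Continuous fun x => F (max c (min x d)) :=
  h.continuousOn.comp_continuous (by fun_prop)
    fun x => ⟨le_max_left _ _, max_le hcd (min_le_right _ _)⟩

/-! ### Cut-offs and null sets -/

theorem isPrimOn_of_fext_eq_zero {a b : EReal} {f : ℝ → ℝ} {F : EReal → ℝ} {E : Set EReal}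
    (hf : ∀ t ∈ E, fext f t = 0) (hF : ∀ t ∈ E, ∀ᶠ x in 𝓝[Icc a b] t, F x = F t) :
    IsPrimOn a b f F E := by
  have h0 : IsPrimOn a b (fun _ => 0) (fun _ => 0) univ := by
    simpa using IsPrimOn.sum (a := a) (b := b) (∅ : Finset ℕ) (f := fun _ _ => 0)
      (F := fun _ _ => 0) (E := univ) (by simp)
  refine h0.of_locally_eq fun t ht _ => ⟨mem_univ t, ?_, ?_⟩
  · rw [hf t ht]; unfold fext; split_ifs <;> rfl
  · filter_upwards [hF t ht, self_mem_nhdsWithin] with x hx hm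
    exact ⟨hm, by rw [hx]⟩

/-- Cutting an integrable function off outside of `(c, d)`. -/
theorem IsPrim.indicator {c d : EReal} (hcd : c ≤ d) {f : ℝ → ℝ} {F : EReal → ℝ}
    (h : IsPrim c d f F) (a b : EReal) :
    IsPrim a b ({x : ℝ | (x : EReal) ∈ Ioo c d}.indicator f) fun x => F (max c (min x d)) := by
  have hc := h.continuous_clamp hcd
  have hfi : ∀ t ∈ Ioo c d, fext ({x : ℝ | (x : EReal) ∈ Ioo c d}.indicator f) t = fext f t := by
    intro t ht
    induction t with
    | bot => simp [fext_bot]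
    | top => simp [fext_top]
    | coe x => rw [fext_coe, fext_coe, indicator_of_mem (by exact ht)]
  have hfo : ∀ t ∉ Ioo c d, fext ({x : ℝ | (x : EReal) ∈ Ioo c d}.indicator f) t = 0 := by
    intro t ht
    induction t with
    | bot => simp [fext_bot]
    | top => simp [fext_top]
    | coe x => rw [fext_coe, indicator_of_notMem (by exact ht)]
  have hlow : IsPrimOn a b ({x : ℝ | (x : EReal) ∈ Ioo c d}.indicator f)
      (fun x => F (max c (min x d))) (Iio c) :=
    isPrimOn_of_fext_eq_zero (fun t ht => hfo t fun h' => lt_asymm h'.1 ht) fun t ht => by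
      filter_upwards [nhdsWithin_le_nhds (Iio_mem_nhds ht)] with x hx
      simp only [mem_Iio] at hx ht
      rw [max_eq_left ((min_le_left _ _).trans ht.le),
        max_eq_left ((min_le_left _ _).trans hx.le)]
  have hhigh : IsPrimOn a b ({x : ℝ | (x : EReal) ∈ Ioo c d}.indicator f)
      (fun x => F (max c (min x d))) (Ioi d) :=
    isPrimOn_of_fext_eq_zero (fun t ht => hfo t fun h' => lt_asymm h'.2 ht) fun t ht => by
      filter_upwards [nhdsWithin_le_nhds (Ioi_mem_nhds ht)] with x hx
      simp only [mem_Ioi] at hx ht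
      rw [min_eq_right ht.le, min_eq_right hx.le]
  have hmid : IsPrimOn a b ({x : ℝ | (x : EReal) ∈ Ioo c d}.indicator f)
      (fun x => F (max c (min x d))) (Ioo c d) := by
    refine IsPrimOn.of_locally_eq h fun t ht _ => ⟨mem_univ t, hfi t ht, ?_⟩
    filter_upwards [nhdsWithin_le_nhds (Ioo_mem_nhds ht.1 ht.2)] with x hx
    refine ⟨Ioo_subset_Icc_self hx, ?_⟩
    rw [min_eq_left hx.2.le, max_eq_right hx.1.le, min_eq_left ht.2.le, max_eq_right ht.1.le]
    ring
  -- The clamped primitive is locally constant outside [c, d] and agrees with F inside; at c and d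
  -- continuity suffices.
  refine ((((hlow.union hhigh).union hmid).union
    (isPrimOn_singleton _ (t := c) hc.continuousWithinAt)).union
    (isPrimOn_singleton _ (t := d) hc.continuousWithinAt)).mono fun t _ => ?_
  simp only [mem_union, mem_Iio, mem_Ioi, mem_Ioo, mem_singleton_iff]
  rcases lt_trichotomy t c with h1 | h1 | h1 <;> rcases lt_trichotomy t d with h2 | h2 | h2 <;>
    tauto

/-- Split the tags by |f| ≤ m. Cover the exceptional null set by an open G of measure below ε / (m +
1); then m times the measure of G to the left of x is a majorant, since an interval close to a tag
in G lies in G. -/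
theorem isPrim_zero_of_ae {a b : EReal} {f : ℝ → ℝ}
    (h : ∀ᵐ x : ℝ, (x : EReal) ∈ Icc a b → f x = 0) : IsPrim a b f fun _ => 0 := by
  set N : Set ℝ := {x | ¬ ((x : EReal) ∈ Icc a b → f x = 0)} with hN
  have hN0 : volume N = 0 := h
  have key : ∀ m : ℕ, IsPrimOn a b f (fun _ => 0) {t | |fext f t| ≤ m} := by
    intro m ε hε
    obtain ⟨G, hNG, hGo, hG⟩ := N.exists_isOpen_lt_of_lt (μ := volume)
      (ENNReal.ofReal (ε / (m + 1))) (by rw [hN0]; simpa using by positivity)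
    have hfin : ∀ s : Set ℝ, volume (G ∩ s) ≠ ∞ := fun s =>
      ((measure_mono inter_subset_left).trans_lt (hG.trans ENNReal.ofReal_lt_top)).ne
    have hmeas : ∀ x : EReal, MeasurableSet (G ∩ {y : ℝ | (y : EReal) < x}) := fun x =>
      hGo.measurableSet.inter (measurableSet_lt measurable_coe_real_ereal measurable_const)
    refine ⟨fun x => m * volume.real (G ∩ {y : ℝ | (y : EReal) < x}), ?_, ?_, ?_⟩
    · intro x y hxy
      refine mul_le_mul_of_nonneg_left (measureReal_mono ?_ (hfin _)) (by positivity)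
      exact inter_subset_inter_right _ fun z hz => lt_of_lt_of_le hz hxy
    · intro x
      refine ⟨by positivity, ?_⟩
      have h1 : volume.real (G ∩ {y : ℝ | (y : EReal) < x}) ≤ ε / (m + 1) := by
        refine ENNReal.toReal_le_of_le_ofReal (by positivity) ?_
        exact (measure_mono inter_subset_left).trans hG.le
      calc _ ≤ (m : ℝ) * (ε / (m + 1)) := mul_le_mul_of_nonneg_left h1 (Nat.cast_nonneg m)
        _ ≤ ε := by
          rw [← mul_div_assoc, div_le_iff₀ (by positivity)]; nlinarith
    · intro t ht
      by_cases htm : t ∈ Icc a b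
      · by_cases ht0 : fext f t = 0
        · filter_upwards [eventually_mem_prod_nhdsWithin_Icc a b t] with p hp
          simp only [ht0, zero_mul, sub_zero, abs_zero, sub_nonneg]
          refine mul_le_mul_of_nonneg_left (measureReal_mono ?_ (hfin _)) (by positivity)
          exact inter_subset_inter_right _ fun z hz =>
            lt_of_lt_of_le hz (hp.1.2.trans hp.2.1)
        · induction t with
          | bot => exact absurd (fext_bot f) ht0
          | top => exact absurd (fext_top f) ht0
          | coe x =>
            have hx : x ∈ G := hNG fun h' => ht0 (by rw [fext_coe]; exact h' htm)
            obtain ⟨δ, hδ, hball⟩ := Metric.isOpen_iff.mp hGo x hx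
            have hnear : ∀ᶠ y : EReal in 𝓝 (x : EReal), ∃ z : ℝ, y = z ∧ z ∈ Metric.ball x δ := by
              rw [← EReal.isOpenEmbedding_coe.map_nhds_eq x]
              exact Filter.eventually_map.mpr
                (Filter.mem_of_superset (Metric.ball_mem_nhds x hδ) fun z hz => ⟨z, rfl, hz⟩)
            have h2 := (hnear.prod_mk hnear).filter_mono
              (Filter.prod_mono (nhdsWithin_le_nhds (s := Icc a (x : EReal)))
                (nhdsWithin_le_nhds (s := Icc (x : EReal) b)))
            filter_upwards [h2, eventually_mem_prod_nhdsWithin_Icc a b x] with p hp hm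
            obtain ⟨p₁, p₂⟩ := p
            obtain ⟨⟨u, hu, hub⟩, v, hv, hvb⟩ := hp
            dsimp only at hu hv
            subst hu hv
            have huv : u ≤ v := by
              have : (u : EReal) ≤ v := hm.1.2.trans hm.2.1
              exact_mod_cast this
            have hsub : Ico u v ⊆ G := fun z hz => hball (by
              rw [Real.ball_eq_Ioo] at *
              exact ⟨hub.1.trans_le hz.1, hz.2.trans hvb.2⟩)
            have hun : (G ∩ {y : ℝ | (y : EReal) < (u : EReal)}) ∪ Ico u v ⊆
                G ∩ {y : ℝ | (y : EReal) < (v : EReal)} := by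
              rintro z (hz | hz)
              · exact ⟨hz.1, lt_of_lt_of_le (b := (u : EReal)) hz.2 (by exact_mod_cast huv)⟩
              · exact ⟨hsub hz, by have := hz.2; exact_mod_cast this⟩
            have h3 := measureReal_mono (μ := volume) hun (hfin _)
            rw [measureReal_union ?_ measurableSet_Ico (hfin _) (by simp), Real.volume_real_Ico_of_le huv] at h3
            · have h4 : |fext f x| ≤ m := ht
              simp only [EReal.toReal_coe, sub_zero, abs_mul, abs_of_nonneg (sub_nonneg.mpr huv)]
              nlinarith [abs_nonneg (fext f x)]
            · rw [Set.disjoint_left]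
              rintro z ⟨-, hz⟩ hz'
              have hz : z < u := by exact_mod_cast (show (z : EReal) < u from hz)
              exact absurd hz'.1 (not_le.mpr hz)
      · simp [prod_nhdsWithin_Icc_eq_bot htm]
  refine (IsPrimOn.iUnion key).mono fun t _ => ?_
  obtain ⟨m, hm⟩ := exists_nat_ge |fext f t|
  exact mem_iUnion.mpr ⟨m, hm⟩

theorem IsPrim.congr_ae {a b : EReal} {f f' : ℝ → ℝ} {F : EReal → ℝ} (h : IsPrim a b f F)
    (hf : ∀ᵐ x : ℝ, (x : EReal) ∈ Icc a b → f x = f' x) : IsPrim a b f' F := by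
  have h1 : IsPrim a b (fun x => f' x - f x) fun _ => 0 :=
    isPrim_zero_of_ae (hf.mono fun x hx hm => by rw [hx hm]; ring)
  simpa [IsPrim] using IsPrimOn.add h h1

theorem IsPrim.hkIntegrable {a b c d : EReal} {f : ℝ → ℝ} {F : EReal → ℝ} (h : IsPrim a b f F)
    (hac : a ≤ c) (hdb : d ≤ b) : HKIntegrable c d f :=
  ⟨_, (h.mono_interval hac hdb).hasHKIntegral⟩

theorem IsPrim.hkIntegral {a b c d : EReal} {f : ℝ → ℝ} {F : EReal → ℝ} (h : IsPrim a b f F)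
    (hac : a ≤ c) (hcd : c ≤ d) (hdb : d ≤ b) : hkIntegral c d f = F d - F c :=
  ((h.mono_interval hac hdb).hasHKIntegral).hkIntegral_eq hcd

/-! ### Multiplication by functions of bounded variation -/

/-- The Riemann--Stieltjes integral of a continuous function against a monotone one. -/
theorem exists_stieltjes_integral {a b : EReal} {F h : EReal → ℝ}
    (hF : Continuous F) (hh : MonotoneOn h (Icc a b)) :
    ∃ J : EReal → ℝ, ∀ u v, a ≤ u → u ≤ v → v ≤ b → ∀ c ω : ℝ, (∀ x ∈ Icc u v, |F x - c| ≤ ω) →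
      |J v - J u - c * (h v - h u)| ≤ ω * (h v - h u) := by
  -- A generalised inverse of h: substituting y = h(x) turns the Stieltjes integral into the
  -- Lebesgue integral of the bounded measurable F ∘ φ.
  set φ : ℝ → EReal := fun y => sSup {x | x ∈ Icc a b ∧ h x < y} with hφ
  have hφm : Monotone φ := fun y z hyz => sSup_le_sSup fun x hx => ⟨hx.1, hx.2.trans_le hyz⟩
  have hm : Measurable fun y => F (φ y) := hF.measurable.comp hφm.measurable
  obtain ⟨C, hC⟩ := isCompact_univ.exists_bound_of_continuousOn hF.continuousOn
  have hint : ∀ y z, IntervalIntegrable (fun y => F (φ y)) volume y z := fun y z =>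
    (intervalIntegrable_const (c := C)).mono_fun' hm.aestronglyMeasurable
      (Eventually.of_forall fun x => hC _ (mem_univ _))
  refine ⟨fun x => ∫ y in (h a)..(h x), F (φ y), fun u v hau huv hvb c ω hω => ?_⟩
  have hle : h u ≤ h v := hh ⟨hau, huv.trans hvb⟩ ⟨hau.trans huv, hvb⟩ huv
  have e : (∫ y in (h a)..(h v), F (φ y)) - (∫ y in (h a)..(h u), F (φ y)) - c * (h v - h u) =
      ∫ y in (h u)..(h v), (F (φ y) - c) := by
    rw [intervalIntegral.integral_interval_sub_left (hint _ _) (hint _ _),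
      intervalIntegral.integral_sub (hint _ _) intervalIntegrable_const,
      intervalIntegral.integral_const, smul_eq_mul, mul_comm c]
  rw [e, ← Real.norm_eq_abs, ← abs_of_nonneg (sub_nonneg.mpr hle)]
  refine intervalIntegral.norm_integral_le_of_norm_le_const fun y hy => ?_
  rw [uIoc_of_le hle] at hy
  -- For h u < y ≤ h v, the point φ y lies in [u, v].
  refine hω _ ⟨le_sSup ⟨⟨hau, huv.trans hvb⟩, hy.1⟩, sSup_le fun x hx => ?_⟩
  by_contra hvx
  exact absurd (hx.2.trans_le hy.2) (not_lt.mpr (hh ⟨hau.trans huv, hvb⟩ hx.1 (not_le.mp hvx).le))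

/-- Integration by parts: H = h F - J, with J the Stieltjes integral of F against h. -/
theorem IsPrim.mul_monotoneOn {a b : EReal} (hab : a ≤ b) {f : ℝ → ℝ} {F h : EReal → ℝ}
    (hf : IsPrim a b f F) (hh : MonotoneOn h (Icc a b)) :
    ∃ H : EReal → ℝ, IsPrim a b (fun x => f x * h x) H ∧
      ∀ u v, a ≤ u → u ≤ v → v ≤ b → ∀ ω : ℝ, (∀ x ∈ Icc u v, |F x - F u| ≤ ω) →
        |H v - H u - h v * (F v - F u)| ≤ ω * (h v - h u) := by
  have hclamp : ∀ x ∈ Icc a b, max a (min x b) = x := fun x hx => by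
    rw [min_eq_left hx.2, max_eq_right hx.1]
  have hcmem : ∀ x, max a (min x b) ∈ Icc a b := fun x =>
    ⟨le_max_left _ _, max_le hab (min_le_right _ _)⟩
  have hG := hf.continuous_clamp hab
  obtain ⟨J, hJ⟩ := exists_stieltjes_integral hG hh
  have hJ' : ∀ u v, a ≤ u → u ≤ v → v ≤ b → ∀ c ω : ℝ, (∀ x ∈ Icc u v, |F x - c| ≤ ω) →
      |J v - J u - c * (h v - h u)| ≤ ω * (h v - h u) := fun u v hu huv hv c ω hω =>
    hJ u v hu huv hv c ω fun x hx => by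
      rw [hclamp x ⟨hu.trans hx.1, hx.2.trans hv⟩]; exact hω x hx
  have ha : a ∈ Icc a b := ⟨le_rfl, hab⟩
  have hb : b ∈ Icc a b := ⟨hab, le_rfl⟩
  set B := |h a| + |h b| + 1 with hB
  have hBpos : 0 < B := by positivity
  have hhB : ∀ x ∈ Icc a b, |h x| ≤ B := fun x hx => by
    have h1 := hh ha hx hx.1
    have h2 := hh hx hb hx.2
    rw [abs_le]
    constructor
    · linarith [neg_abs_le (h a), abs_nonneg (h b)]
    · linarith [le_abs_self (h b), abs_nonneg (h a)]
  refine ⟨fun x => h x * F x - J x, fun ε hε => ?_, fun u v hu huv hv ω hω => ?_⟩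
  · obtain ⟨P, hP, hPb, H⟩ := hf (ε / 2 / B) (by positivity)
    -- As h increases by at most 2 B, the term 2 ω (h - h a) of the majorant stays below ε / 2.
    set ω := ε / (8 * B) with hω
    have hωpos : 0 < ω := by positivity
    refine ⟨fun x => B * P x + 2 * ω * (h (max a (min x b)) - h a), ?_, ?_, ?_⟩
    · refine (hP.const_mul hBpos.le).add (Monotone.const_mul (fun x y hxy => ?_) (by positivity))
      exact sub_le_sub_right (hh (hcmem x) (hcmem y) (max_le_max le_rfl (min_le_min hxy le_rfl))) _
    · intro x
      have h1 := hh ha (hcmem x) (hcmem x).1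
      have h2 := hPb x
      refine ⟨add_nonneg (mul_nonneg hBpos.le h2.1)
        (mul_nonneg (by positivity) (sub_nonneg.mpr h1)), ?_⟩
      have h3 : B * P x ≤ ε / 2 := by
        have := h2.2; rw [le_div_iff₀ hBpos] at this; linarith
      have h4 : h (max a (min x b)) - h a ≤ 2 * B := by
        have := (abs_le.mp (hhB _ (hcmem x))).2
        have := (abs_le.mp (hhB _ ha)).1
        linarith
      have h5 : 2 * ω * (h (max a (min x b)) - h a) ≤ 2 * ω * (2 * B) :=
        mul_le_mul_of_nonneg_left h4 (by positivity)
      have h6 : 2 * ω * (2 * B) = ε / 2 := by rw [hω]; field_simp; norm_num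
      linarith
    · intro t _
      by_cases htm : t ∈ Icc a b
      · have hWn : {x | |F (max a (min x b)) - F t| < ω} ∈ 𝓝 t := by
          have := Metric.tendsto_nhds.mp (hG.tendsto t) ω hωpos
          simp only [Real.dist_eq, hclamp t htm] at this
          exact this
        have hIcc : ∀ᶠ p : EReal × EReal in 𝓝 t ×ˢ 𝓝 t,
            Icc p.1 p.2 ⊆ {x | |F (max a (min x b)) - F t| < ω} :=
          ((Filter.tendsto_fst.Icc Filter.tendsto_snd).eventually
            (Filter.eventually_smallSets_subset.2 hWn))
        filter_upwards [H t (mem_univ t), hIcc.filter_mono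
          (Filter.prod_mono nhdsWithin_le_nhds nhdsWithin_le_nhds),
          eventually_mem_prod_nhdsWithin_Icc a b t] with p hp hW hm
        obtain ⟨u, v⟩ := p
        obtain ⟨⟨hau, hut⟩, htv, hvb⟩ := hm
        dsimp only at *
        have huv := hut.trans htv
        have hu : u ∈ Icc a b := ⟨hau, huv.trans hvb⟩
        have hv : v ∈ Icc a b := ⟨hau.trans huv, hvb⟩
        have hWx : ∀ x ∈ Icc u v, |F x - F t| ≤ ω := fun x hx => by
          have := hW hx
          rw [mem_ofPred_eq, hclamp x ⟨hau.trans hx.1, hx.2.trans hvb⟩] at this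
          exact this.le
        have hfx : fext (fun x => f x * h x) t = fext f t * h t := by
          induction t with
          | bot => simp [fext_bot]
          | top => simp [fext_top]
          | coe x => simp [fext_coe]
        rw [hfx, hclamp u hu, hclamp v hv]
        have j1 := hJ' u v hau huv hvb (F t) ω hWx
        have j2 := hWx u ⟨le_rfl, huv⟩
        have j3 := hWx v ⟨huv, le_rfl⟩
        have m1 := hh hu htm hut
        have m2 := hh htm hv htv
        -- The first term is controlled by P. The two products of increments and the Stieltjes
        -- remainder each contribute ω times an increment of h, together 2 ω (h v - h u).
        have e : fext f t * h t * (v.toReal - u.toReal) -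
            (h v * F v - J v - (h u * F u - J u)) =
            h t * (fext f t * (v.toReal - u.toReal) - (F v - F u)) - (h v - h t) * (F v - F t)
              - (h t - h u) * (F u - F t) + (J v - J u - F t * (h v - h u)) := by ring
        have k1 : |h t * (fext f t * (v.toReal - u.toReal) - (F v - F u))| ≤ B * (P v - P u) := by
          rw [abs_mul]
          exact mul_le_mul (hhB t htm) hp (abs_nonneg _) hBpos.le
        have k2 : |(h v - h t) * (F v - F t)| ≤ (h v - h t) * ω := by
          rw [abs_mul, abs_of_nonneg (sub_nonneg.mpr m2)]
          exact mul_le_mul_of_nonneg_left j3 (sub_nonneg.mpr m2)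
        have k3 : |(h t - h u) * (F u - F t)| ≤ (h t - h u) * ω := by
          rw [abs_mul, abs_of_nonneg (sub_nonneg.mpr m1)]
          exact mul_le_mul_of_nonneg_left j2 (sub_nonneg.mpr m1)
        rw [e]
        rw [abs_le] at *
        constructor <;> linarith
      · simp [prod_nhdsWithin_Icc_eq_bot htm]
  · have := hJ' u v hu huv hv (F u) ω hω
    have e : h v * F v - J v - (h u * F u - J u) - h v * (F v - F u) =
      -(J v - J u - F u * (h v - h u)) := by ring
    dsimp only
    rwa [e, abs_neg]

/-- The product of an integrable function and a function of bounded variation. -/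
theorem IsPrim.mul_boundedVariationOn {a b : EReal} (hab : a ≤ b) {f : ℝ → ℝ} {F k : EReal → ℝ}
    (hf : IsPrim a b f F) (hk : BoundedVariationOn k (Icc a b)) :
    ∃ H : EReal → ℝ, IsPrim a b (fun x => f x * k x) H ∧
      ∀ u v, a ≤ u → u ≤ v → v ≤ b → ∀ ω : ℝ, (∀ x ∈ Icc u v, |F x - F u| ≤ ω) →
        |H v - H u - k v * (F v - F u)| ≤ 3 * ω * (eVariationOn k (Icc u v)).toReal := by
  have ha : a ∈ Icc a b := ⟨le_rfl, hab⟩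
  have hl := hk.locallyBoundedVariationOn
  have hp := variationOnFromTo.monotoneOn hl ha
  have hq := variationOnFromTo.sub_self_monotoneOn hl ha
  obtain ⟨H₁, hH₁, hb₁⟩ := hf.mul_monotoneOn hab hp
  obtain ⟨H₂, hH₂, hb₂⟩ := hf.mul_monotoneOn hab hq
  -- Jordan decomposition: k is its variation function minus the monotone remainder. The former
  -- increases by V over [u, v], the latter by at most 2 V, whence the constant 3.
  refine ⟨fun x => H₁ x + (-1) * H₂ x, ?_, fun u v hu huv hv ω hω => ?_⟩
  · have := IsPrimOn.add hH₁ (IsPrimOn.const_mul (-1) hH₂)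
    have e : (fun x : ℝ => f x * k x) = fun x : ℝ => f x * variationOnFromTo k (Icc a b) a x +
        -1 * (f x * (variationOnFromTo k (Icc a b) a - k) x) := by
      ext x; simp only [Pi.sub_apply]; ring
    unfold IsPrim
    rw [e]
    exact this
  · have hu' : u ∈ Icc a b := ⟨hu, huv.trans hv⟩
    have hv' : v ∈ Icc a b := ⟨hu.trans huv, hv⟩
    have h1 := hb₁ u v hu huv hv ω hω
    have h2 := hb₂ u v hu huv hv ω hω
    have hadd := variationOnFromTo.add hl ha hu' hv'
    have e : variationOnFromTo k (Icc a b) u v = (eVariationOn k (Icc u v)).toReal := by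
      rw [variationOnFromTo.eq_of_le _ _ huv, inter_eq_self_of_subset_right (Icc_subset_Icc hu hv)]
    have hd : |k v - k u| ≤ (eVariationOn k (Icc u v)).toReal := by
      rw [← Real.dist_eq, dist_edist]
      refine ENNReal.toReal_mono (ne_top_of_le_ne_top hk (eVariationOn.mono _
        (Icc_subset_Icc hu hv))) (eVariationOn.edist_le _ ⟨huv, le_rfl⟩ ⟨le_rfl, huv⟩)
    rw [e] at hadd
    simp only [Pi.sub_apply] at h2
    have hω0 : 0 ≤ ω := (abs_nonneg _).trans (hω u ⟨le_rfl, huv⟩)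
    have h3 : ω * |k v - k u| ≤ ω * (eVariationOn k (Icc u v)).toReal :=
      mul_le_mul_of_nonneg_left hd hω0
    have h4 : -(ω * (k v - k u)) ≤ ω * |k v - k u| := by
      rw [← mul_neg]; exact mul_le_mul_of_nonneg_left (neg_le_abs _) hω0
    rw [abs_le] at h1 h2 ⊢
    constructor <;> nlinarith

/-! ### Almost everywhere symmetric differentiation of primitives -/

/-- Bad intervals [x - δ, x + δ] are no longer than the increment of Q = P / η over them, and Q
takes values in [0, ε]. A disjoint Besicovitch subfamily covers almost all of the set, so its
measure is at most ε. Centred balls are why the derivative is symmetric. -/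
theorem measure_frequently_symmetric_quotient_eq_zero {c d : EReal} {k : ℝ → ℝ} {K : EReal → ℝ}
    (h : IsPrim c d k K) {η : ℝ} (hη : 0 < η) :
    volume {x : ℝ | (x : EReal) ∈ Ioo c d ∧ ∃ᶠ δ in 𝓝[>] (0 : ℝ),
      η * (2 * δ) < |k x * (2 * δ) - (K ((x + δ : ℝ) : EReal) - K ((x - δ : ℝ) : EReal))|} = 0 := by
  set s := {x : ℝ | (x : EReal) ∈ Ioo c d ∧ ∃ᶠ δ in 𝓝[>] (0 : ℝ),
      η * (2 * δ) < |k x * (2 * δ) - (K ((x + δ : ℝ) : EReal) - K ((x - δ : ℝ) : EReal))|} with hs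
  refine le_antisymm (ENNReal.le_of_forall_pos_le_add fun ε hε _ => ?_) zero_le
  have hε' : (0 : ℝ) < ε := hε
  obtain ⟨P, hP, hPb, H⟩ := h (ε * η) (by positivity)
  set Q : ℝ → ℝ := fun x => P x / η with hQ
  have hQm : Monotone Q := fun x y hxy =>
    div_le_div_of_nonneg_right (hP (by exact_mod_cast hxy)) hη.le
  set R : ℝ → Set ℝ := fun x => {δ | 0 < δ ∧ 2 * δ ≤ Q (x + δ) - Q (x - δ)} with hR
  have hfreq : ∀ x ∈ s, ∃ᶠ δ in 𝓝[>] (0 : ℝ), δ ∈ R x := by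
    rintro x ⟨⟨hcx, hxd⟩, hx⟩
    have hcont1 : Tendsto (fun δ : ℝ => ((x - δ : ℝ) : EReal)) (𝓝[>] 0) (𝓝 (x : EReal)) := by
      refine (EReal.continuous_coe_iff.mpr continuous_id).continuousAt.tendsto.comp ?_
      have : Tendsto (fun δ : ℝ => x - δ) (𝓝 0) (𝓝 (x - 0)) := by
        apply Continuous.tendsto; fun_prop
      rw [sub_zero] at this
      exact this.mono_left nhdsWithin_le_nhds
    have hcont2 : Tendsto (fun δ : ℝ => ((x + δ : ℝ) : EReal)) (𝓝[>] 0) (𝓝 (x : EReal)) := by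
      refine (EReal.continuous_coe_iff.mpr continuous_id).continuousAt.tendsto.comp ?_
      have : Tendsto (fun δ : ℝ => x + δ) (𝓝 0) (𝓝 (x + 0)) := by
        apply Continuous.tendsto; fun_prop
      rw [add_zero] at this
      exact this.mono_left nhdsWithin_le_nhds
    have hpos : ∀ᶠ δ in 𝓝[>] (0 : ℝ), 0 < δ := eventually_mem_nhdsWithin
    have t1 : Tendsto (fun δ : ℝ => ((x - δ : ℝ) : EReal)) (𝓝[>] 0) (𝓝[Icc c x] (x : EReal)) := by
      refine tendsto_nhdsWithin_iff.mpr ⟨hcont1, ?_⟩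
      filter_upwards [hcont1.eventually (Ioi_mem_nhds hcx), hpos] with δ h1 h2
      exact ⟨le_of_lt h1, by norm_cast; linarith⟩
    have t2 : Tendsto (fun δ : ℝ => ((x + δ : ℝ) : EReal)) (𝓝[>] 0) (𝓝[Icc (x : EReal) d] x) := by
      refine tendsto_nhdsWithin_iff.mpr ⟨hcont2, ?_⟩
      filter_upwards [hcont2.eventually (Iio_mem_nhds hxd), hpos] with δ h1 h2
      exact ⟨by norm_cast; linarith, le_of_lt h1⟩
    refine (hx.and_eventually (hpos.and ((t1.prodMk t2).eventually (H x (mem_univ _))))).mono ?_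
    rintro δ ⟨h1, h2, h3⟩
    refine ⟨h2, ?_⟩
    simp only [EReal.toReal_coe, fext_coe] at h3
    have e : x + δ - (x - δ) = 2 * δ := by ring
    rw [e] at h3
    simp only [hQ]
    rw [← sub_div, le_div_iff₀ hη]
    linarith
  obtain ⟨t, r, htc, hts, htr, hcov, hdisj⟩ :=
    Besicovitch.exists_disjoint_closedBall_covering_ae volume R s (fun x hx δ hδ => by
      have hI : Ioo 0 δ ∈ 𝓝[>] (0 : ℝ) := Ioo_mem_nhdsGT hδ
      obtain ⟨y, hy, hy'⟩ := ((hfreq x hx).and_eventually hI).exists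
      exact ⟨y, hy, hy'⟩) (fun _ => 1) (fun _ _ => one_pos)
  have h1 : volume s ≤ volume (⋃ x ∈ t, Metric.closedBall x (r x)) :=
    calc volume s ≤ volume ((s \ ⋃ x ∈ t, Metric.closedBall x (r x)) ∪
          ⋃ x ∈ t, Metric.closedBall x (r x)) := measure_mono fun x hx => by
            by_cases hx' : x ∈ ⋃ x ∈ t, Metric.closedBall x (r x)
            · exact .inr hx'
            · exact .inl ⟨hx, hx'⟩
      _ ≤ _ := (measure_union_le _ _).trans (by rw [hcov, zero_add])
  -- Monotonicity of Q carries disjoint balls to disjoint increment intervals, all inside [0, ε].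
  have hdisj' : t.PairwiseDisjoint fun x => Ioo (Q (x - r x)) (Q (x + r x)) := by
    have key : ∀ x ∈ t, ∀ y ∈ t, x < y →
        Disjoint (Ioo (Q (x - r x)) (Q (x + r x))) (Ioo (Q (y - r y)) (Q (y + r y))) := by
      intro x hx y hy hxy
      have hd := hdisj hx hy hxy.ne
      have rx := (htr x hx).1.1
      have ry := (htr y hy).1.1
      have : x + r x < y - r y := by
        by_contra hcon
        push Not at hcon
        have hd' : Disjoint (Metric.closedBall x (r x)) (Metric.closedBall y (r y)) := hd
        rw [Real.closedBall_eq_Icc, Real.closedBall_eq_Icc, Set.disjoint_left] at hd'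
        refine hd' (?_ : min (x + r x) (y + r y) ∈ _) ?_
        · exact ⟨le_min (by linarith) (by linarith), min_le_left _ _⟩
        · exact ⟨le_min hcon (by linarith), min_le_right _ _⟩
      rw [Set.disjoint_left]
      intro z hz hz'
      have := hQm this.le
      linarith [hz.2, hz'.1]
    intro x hx y hy hxy
    rcases lt_or_gt_of_ne hxy with h' | h'
    · exact key x hx y hy h'
    · exact (key y hy x hx h').symm
  rw [zero_add]
  calc volume s ≤ ∑' x : t, volume (Metric.closedBall (x : ℝ) (r x)) :=
        h1.trans (measure_biUnion_le _ htc _)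
    _ ≤ ∑' x : t, volume (Ioo (Q (x - r x)) (Q (x + r x))) := by
        refine ENNReal.tsum_le_tsum fun x => ?_
        rw [Real.volume_closedBall, Real.volume_Ioo]
        exact ENNReal.ofReal_le_ofReal (htr x x.2).1.2
    _ = volume (⋃ x ∈ t, Ioo (Q (x - r x)) (Q (x + r x))) :=
        (measure_biUnion htc hdisj' fun _ _ => measurableSet_Ioo).symm
    _ ≤ volume (Icc 0 (ε : ℝ)) := by
        refine measure_mono (iUnion₂_subset fun x _ => Ioo_subset_Icc_self.trans
          (Icc_subset_Icc ?_ ?_))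
        · exact div_nonneg (hPb _).1 hη.le
        · rw [hQ]; dsimp only; rw [div_le_iff₀ hη]; exact (hPb _).2
    _ = ε := by simp

/-- Almost everywhere, an integrable function is the symmetric derivative of its primitive. -/
theorem IsPrim.ae_tendsto_symmetric_quotient {c d : EReal} {k : ℝ → ℝ} {K : EReal → ℝ}
    (h : IsPrim c d k K) : ∀ᵐ x : ℝ, (x : EReal) ∈ Ioo c d →
      Tendsto (fun δ : ℝ => (K ((x + δ : ℝ) : EReal) - K ((x - δ : ℝ) : EReal)) / (2 * δ))
        (𝓝[>] 0) (𝓝 (k x)) := by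
  have : ∀ᵐ x : ℝ, ∀ m : ℕ, ¬ ((x : EReal) ∈ Ioo c d ∧ ∃ᶠ δ in 𝓝[>] (0 : ℝ),
      1 / ((m : ℝ) + 1) * (2 * δ) <
        |k x * (2 * δ) - (K ((x + δ : ℝ) : EReal) - K ((x - δ : ℝ) : EReal))|) := by
    rw [ae_all_iff]
    intro m
    rw [ae_iff]
    simp only [not_not]
    exact measure_frequently_symmetric_quotient_eq_zero h (by positivity)
  filter_upwards [this] with x hx hxm
  rw [Metric.tendsto_nhds]
  intro ε hε
  obtain ⟨m, hm⟩ := exists_nat_one_div_lt hε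
  have := not_frequently.mp (not_and.mp (hx m) hxm)
  filter_upwards [this, self_mem_nhdsWithin] with δ h1 h2
  have h2 : 0 < 2 * δ := by have : 0 < δ := h2; linarith
  rw [not_lt] at h1
  refine lt_of_le_of_lt ?_ hm
  rw [Real.dist_eq, ← mul_le_mul_iff_left₀ h2]
  refine le_trans (le_of_eq ?_) h1
  rw [← abs_of_pos h2, ← abs_mul, abs_of_pos h2, sub_mul, div_mul_cancel₀ _ h2.ne', abs_sub_comm]

/-! ### Sliding humps: uniform boundedness of multipliers -/

/-- `f` is integrable over `[a, b]` with all integrals over subintervals bounded by `C`. -/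
def AlexiewiczLe (a b : EReal) (f : ℝ → ℝ) (C : ℝ) : Prop :=
  HKIntegrable a b f ∧ ∀ c d, a ≤ c → c ≤ d → d ≤ b → |hkIntegral c d f| ≤ C

/-- Multiplication by the functions `k n` is bounded, uniformly in `n`, when only integrals over
intervals contained in `U` are considered. -/
def UniformMultiplierOn (a b : EReal) (k : ℕ → ℝ → ℝ) (U : Set EReal) : Prop :=
  ∃ M : ℝ, ∀ n s, AlexiewiczLe a b s 1 → ∀ c d, a ≤ c → c ≤ d → d ≤ b → Icc c d ⊆ U →
    |hkIntegral c d fun x => s x * k n x| ≤ M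

theorem ae_coe_ne (c : EReal) : ∀ᵐ x : ℝ, (x : EReal) ≠ c := by
  refine (Set.Countable.ae_notMem (s := {x : ℝ | (x : EReal) = c}) ?_ volume).mono
    fun x hx h => hx h
  refine Set.Subsingleton.countable fun x hx y hy => ?_
  have : (x : EReal) = y := Eq.trans hx (Eq.symm hy)
  exact_mod_cast this

/-- Splitting at z leaves a half with more than A of the increment; continuity then moves its
endpoint off z. -/
theorem exists_interval_avoiding {a b z : EReal} {H : EReal → ℝ} (hH : ContinuousOn H (Icc a b))
    {c d : EReal} (hac : a ≤ c) (hcd : c ≤ d) (hdb : d ≤ b) {A : ℝ} (hA : 0 ≤ A)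
    (h : 2 * A < |H d - H c|) :
    ∃ c' d', c ≤ c' ∧ c' ≤ d' ∧ d' ≤ d ∧ z ∉ Icc c' d' ∧ A < |H d' - H c'| := by
  by_cases hz : z ∈ Icc c d
  · have hzm : z ∈ Icc a b := ⟨hac.trans hz.1, hz.2.trans hdb⟩
    have htri : |H d - H c| ≤ |H d - H z| + |H z - H c| := abs_sub_le _ _ _
    rcases lt_or_ge A |H d - H z| with h1 | h1
    · have hzd : z < d := lt_of_le_of_ne hz.2 (by rintro rfl; simp at h1; linarith)
      have : (𝓝[Ioo z d] z).NeBot := left_nhdsWithin_Ioo_neBot hzd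
      have ht : Tendsto (fun x => |H d - H x|) (𝓝[Ioo z d] z) (𝓝 |H d - H z|) :=
        (tendsto_const_nhds.sub ((hH z hzm).mono_left (nhdsWithin_mono _ fun x hx =>
          ⟨hzm.1.trans hx.1.le, hx.2.le.trans hdb⟩))).abs
      obtain ⟨x, hx, hx'⟩ := ((ht.eventually (lt_mem_nhds h1)).and self_mem_nhdsWithin).exists
      exact ⟨x, d, hz.1.trans hx'.1.le, hx'.2.le, le_rfl, fun h' => not_lt.mpr h'.1 hx'.1, hx⟩
    · have h2 : A < |H z - H c| := by linarith
      have hcz : c < z := lt_of_le_of_ne hz.1 (by rintro rfl; simp at h2; linarith)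
      have : (𝓝[Ioo c z] z).NeBot := right_nhdsWithin_Ioo_neBot hcz
      have ht : Tendsto (fun x => |H x - H c|) (𝓝[Ioo c z] z) (𝓝 |H z - H c|) :=
        (((hH z hzm).mono_left (nhdsWithin_mono _ fun x hx =>
          ⟨hac.trans hx.1.le, hx.2.le.trans hzm.2⟩)).sub tendsto_const_nhds).abs
      obtain ⟨x, hx, hx'⟩ := ((ht.eventually (lt_mem_nhds h2)).and self_mem_nhdsWithin).exists
      exact ⟨c, x, le_rfl, hx'.1.le, hx'.2.le.trans hz.2, fun h' => not_lt.mpr h'.2 hx'.2, hx⟩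
  · exact ⟨c, d, le_rfl, hcd, le_rfl, hz, by linarith⟩

/-- Each hump avoids z, so its interval can be removed from the neighbourhood in which the next hump
is sought. -/
theorem exists_humps {a b : EReal} (hab : a ≤ b) {k : ℕ → ℝ → ℝ}
    (hk : ∀ f, HKIntegrable a b f → ∀ n, HKIntegrable a b fun x => f x * k n x)
    {z : EReal} (hz : ∀ U ∈ 𝓝 z, ¬ UniformMultiplierOn a b k U) {V : ℕ → Set EReal}
    (hV : ∀ j, V j ∈ 𝓝 z) :
    ∃ (n : ℕ → ℕ) (s : ℕ → ℝ → ℝ) (c d : ℕ → EReal), (∀ j, AlexiewiczLe a b (s j) 1) ∧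
      (∀ j, a ≤ c j ∧ c j ≤ d j ∧ d j ≤ b) ∧ (∀ j, Icc (c j) (d j) ⊆ V j) ∧
      (∀ i j, i < j → Disjoint (Icc (c i) (d i)) (Icc (c j) (d j))) ∧
      ∀ j, 4 ^ j < |hkIntegral (c j) (d j) fun x => s j x * k (n j) x| := by
  have h1 : ∀ (U : {U // U ∈ 𝓝 z}) (j : ℕ), ∃ q : ℕ × (ℝ → ℝ) × EReal × EReal,
      AlexiewiczLe a b q.2.1 1 ∧ (a ≤ q.2.2.1 ∧ q.2.2.1 ≤ q.2.2.2 ∧ q.2.2.2 ≤ b) ∧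
      Icc q.2.2.1 q.2.2.2 ⊆ U ∧ z ∉ Icc q.2.2.1 q.2.2.2 ∧
      4 ^ j < |hkIntegral q.2.2.1 q.2.2.2 fun x => q.2.1 x * k q.1 x| := by
    rintro ⟨U, hU⟩ j
    have := hz U hU
    unfold UniformMultiplierOn at this
    push Not at this
    -- The factor 2 pays for avoiding z.
    obtain ⟨n, s, hs, c, d, hac, hcd, hdb, hsub, hlt⟩ := this (2 * 4 ^ j)
    obtain ⟨H, hH⟩ := (hk s hs.1 n).exists_isPrim hab
    rw [hH.hkIntegral hac hcd hdb] at hlt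
    obtain ⟨c', d', h1, h2, h3, h4, h5⟩ := exists_interval_avoiding (z := z) hH.continuousOn
      hac hcd hdb (by positivity) hlt
    refine ⟨⟨n, s, c', d'⟩, hs, ⟨hac.trans h1, h2, h3.trans hdb⟩,
      (Icc_subset_Icc h1 h3).trans hsub, h4, ?_⟩
    rwa [hH.hkIntegral (hac.trans h1) h2 (h3.trans hdb)]
  choose q q1 q2 q3 q4 q5 using h1
  let U : ℕ → {U // U ∈ 𝓝 z} := fun j => Nat.rec ⟨V 0, hV 0⟩ (fun j U =>
    ⟨U.1 ∩ V (j + 1) ∩ (Icc (q U j).2.2.1 (q U j).2.2.2)ᶜ, inter_mem (inter_mem U.2 (hV _))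
      (isClosed_Icc.isOpen_compl.mem_nhds (q4 U j))⟩) j
  have hUs : ∀ j, (U (j + 1)).1 =
      (U j).1 ∩ V (j + 1) ∩ (Icc (q (U j) j).2.2.1 (q (U j) j).2.2.2)ᶜ := fun j => rfl
  have hUV : ∀ j, (U j).1 ⊆ V j := by
    intro j
    cases j with
    | zero => exact subset_rfl
    | succ j => rw [hUs]; exact inter_subset_left.trans inter_subset_right
  have hanti : Antitone fun j => (U j).1 := antitone_nat_of_succ_le fun j => by
    rw [hUs]; exact inter_subset_left.trans inter_subset_left
  refine ⟨fun j => (q (U j) j).1, fun j => (q (U j) j).2.1, fun j => (q (U j) j).2.2.1,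
    fun j => (q (U j) j).2.2.2, fun j => q1 _ _, fun j => q2 _ _,
    fun j => (q3 _ _).trans (hUV j), fun i j hij => ?_, fun j => q5 _ _⟩
  have h2 : (U j).1 ⊆ (Icc (q (U i) i).2.2.1 (q (U i) i).2.2.2)ᶜ :=
    (hanti hij).trans (by rw [Nat.succ_eq_add_one]; dsimp only; rw [hUs]; exact inter_subset_right)
  exact (subset_compl_iff_disjoint_left.mp ((q3 (U j) j).trans h2))

/-- Humps over disjoint intervals that shrink to a point, with summable weights, add up to an
integrable function. -/
theorem exists_sum_humps {a b : EReal} (hab : a ≤ b) {z : EReal} {s : ℕ → ℝ → ℝ}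
    {c d : ℕ → EReal} (hs : ∀ j, AlexiewiczLe a b (s j) 1)
    (hcd : ∀ j, a ≤ c j ∧ c j ≤ d j ∧ d j ≤ b)
    (hz : ∀ U ∈ 𝓝 z, ∀ᶠ j in atTop, Icc (c j) (d j) ⊆ U)
    (hdisj : ∀ i j, i < j → Disjoint (Icc (c i) (d i)) (Icc (c j) (d j))) :
    ∃ f : ℝ → ℝ, HKIntegrable a b f ∧
      ∀ j, ∀ x : ℝ, (x : EReal) ∈ Ioo (c j) (d j) → f x = (1 / 2) ^ j * s j x := by
  choose S hS using fun j => (hs j).1.exists_isPrim hab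
  have hScd : ∀ j, IsPrim (c j) (d j) (s j) (S j) := fun j =>
    (hS j).mono_interval (hcd j).1 (hcd j).2.2
  set φ : ℕ → ℝ → ℝ := fun j x =>
    (1 / 2) ^ j * {x : ℝ | (x : EReal) ∈ Ioo (c j) (d j)}.indicator (s j) x with hφ
  set Φ : ℕ → EReal → ℝ := fun j x =>
    (1 / 2) ^ j * (S j (max (c j) (min x (d j))) - S j (c j)) with hΦ
  have hΦc : ∀ j, Continuous (Φ j) := fun j =>
    (((hScd j).continuous_clamp (hcd j).2.1).sub continuous_const).const_mul _
  have hΦp : ∀ j, IsPrim a b (φ j) (Φ j) := fun j => by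
    refine IsPrimOn.const_mul _ ?_
    refine IsPrimOn.of_locally_eq ((hScd j).indicator (hcd j).2.1 a b)
      fun t _ _ => ⟨mem_univ t, rfl, ?_⟩
    filter_upwards [self_mem_nhdsWithin] with x hx
    exact ⟨hx, by ring⟩
  have hΦb : ∀ j x, ‖Φ j x‖ ≤ (1 / 2) ^ j := fun j x => by
    have h1 : c j ≤ max (c j) (min x (d j)) := le_max_left _ _
    have h2 : max (c j) (min x (d j)) ≤ d j := max_le (hcd j).2.1 (min_le_right _ _)
    have h3 := (hs j).2 _ _ (hcd j).1 h1 (h2.trans (hcd j).2.2)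
    rw [(hS j).hkIntegral (hcd j).1 h1 (h2.trans (hcd j).2.2)] at h3
    rw [Real.norm_eq_abs, abs_mul, abs_of_pos (by positivity)]
    exact mul_le_of_le_one_right (by positivity) h3
  have hsummable : Summable fun j : ℕ => (1 / 2 : ℝ) ^ j := summable_geometric_two
  have hΦs : ∀ x, Summable fun j => Φ j x := fun x =>
    Summable.of_norm_bounded hsummable fun j => hΦb j x
  set f : ℝ → ℝ := fun x => ∑' j, φ j x with hf
  set F : EReal → ℝ := fun x => ∑' j, Φ j x with hF
  have hFc : Continuous F := continuous_tsum hΦc hsummable hΦb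
  -- Near a tag of `E N` only the first N humps are active, so f is locally a finite sum. Every
  -- point except z lies in some `E N`, and at z continuity of the uniform limit F suffices.
  set E : ℕ → Set EReal := fun N =>
    {t | ∀ᶠ x in 𝓝 t, ∀ j ≥ N, x ∉ Ioo (c j) (d j) ∧ Φ j x = Φ j t} with hE
  have hEp : ∀ N, IsPrimOn a b f F (E N) := by
    intro N
    have h0 : IsPrimOn a b (fun x => ∑ j ∈ Finset.range N, φ j x)
        (fun x => ∑ j ∈ Finset.range N, Φ j x) univ := IsPrimOn.sum _ fun j _ => hΦp j
    refine h0.of_locally_eq fun t ht _ => ⟨mem_univ t, ?_, ?_⟩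
    · induction t with
      | bot => simp [fext_bot]
      | top => simp [fext_top]
      | coe x =>
        rw [fext_coe, fext_coe]
        refine tsum_eq_sum fun j hj => ?_
        have := (ht.self_of_nhds j (by simpa using hj)).1
        simp only [hφ]
        rw [indicator_of_notMem (by exact this), mul_zero]
    · filter_upwards [nhdsWithin_le_nhds ht, self_mem_nhdsWithin] with x hx hm
      refine ⟨hm, ?_⟩
      simp only [hF]
      rw [← (hΦs x).sum_add_tsum_nat_add N, ← (hΦs t).sum_add_tsum_nat_add N,
        add_sub_cancel_left, add_sub_cancel_left]
      exact tsum_congr fun j => (hx (j + N) (by omega)).2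
  have hprim : IsPrim a b f F := by
    refine ((IsPrimOn.iUnion hEp).union
      (isPrimOn_singleton f (t := z) hFc.continuousWithinAt)).mono fun t _ => ?_
    rcases lt_trichotomy t z with h | h | h
    · obtain ⟨w, hw1, hw2⟩ := exists_between h
      obtain ⟨N, hN⟩ := eventually_atTop.mp (hz _ (Ioi_mem_nhds hw2))
      refine .inl (mem_iUnion.mpr ⟨N, ?_⟩)
      filter_upwards [Iio_mem_nhds hw1] with x hx j hj
      have h1 : w < c j := hN j hj ⟨le_rfl, (hcd j).2.1⟩
      have hc : ∀ y < w, max (c j) (min y (d j)) = c j := fun y hy =>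
        max_eq_left ((min_le_left _ _).trans (hy.trans h1).le)
      refine ⟨fun hx' => lt_asymm hx'.1 (lt_trans hx h1), ?_⟩
      simp only [hΦ]
      rw [hc x hx, hc t hw1]
    · exact .inr h
    · obtain ⟨w, hw1, hw2⟩ := exists_between h
      obtain ⟨N, hN⟩ := eventually_atTop.mp (hz _ (Iio_mem_nhds hw1))
      refine .inl (mem_iUnion.mpr ⟨N, ?_⟩)
      filter_upwards [Ioi_mem_nhds hw2] with x hx j hj
      have h1 : d j < w := hN j hj ⟨(hcd j).2.1, le_rfl⟩
      have hc : ∀ y > w, max (c j) (min y (d j)) = d j := fun y hy => by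
        rw [min_eq_right (h1.trans hy).le, max_eq_right (hcd j).2.1]
      refine ⟨fun hx' => lt_asymm hx'.2 (h1.trans hx), ?_⟩
      simp only [hΦ]
      rw [hc x hx, hc t hw2]
  refine ⟨f, hprim.hkIntegrable le_rfl le_rfl, fun j x hx => ?_⟩
  simp only [hf]
  rw [tsum_eq_single j]
  · simp only [hφ]
    rw [indicator_of_mem (by exact hx)]
  · intro i hij
    simp only [hφ]
    rw [indicator_of_notMem, mul_zero]
    intro hx'
    have hx'' : (x : EReal) ∈ Ioo (c i) (d i) := hx'
    rcases lt_or_gt_of_ne hij with h | h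
    · exact Set.disjoint_left.mp (hdisj i j h) (Ioo_subset_Icc_self hx'')
        (Ioo_subset_Icc_self hx)
    · exact Set.disjoint_left.mp (hdisj j i h) (Ioo_subset_Icc_self hx)
        (Ioo_subset_Icc_self hx'')

/-- Otherwise humps with integrals above 4 ^ j, weighted by 2 ^ (-j), sum to an integrable f whose
products have norms above 2 ^ j. -/
theorem exists_nhds_uniformMultiplierOn {a b : EReal} (hab : a ≤ b) {k : ℕ → ℝ → ℝ}
    (hk : ∀ f, HKIntegrable a b f → ∃ C, ∀ n, AlexiewiczLe a b (fun x => f x * k n x) C)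
    (z : EReal) : ∃ U ∈ 𝓝 z, UniformMultiplierOn a b k U := by
  by_contra! hz
  have hk' : ∀ f, HKIntegrable a b f → ∀ n, HKIntegrable a b fun x => f x * k n x :=
    fun f hf n => let ⟨_, hC⟩ := hk f hf; (hC n).1
  obtain ⟨V, hV⟩ := (𝓝 z).exists_antitone_basis
  obtain ⟨n, s, c, d, hs, hcd, hVcd, hdisj, hlarge⟩ := exists_humps hab hk' hz
    (fun j => hV.mem j)
  obtain ⟨f, hf, hfeq⟩ := exists_sum_humps hab hs hcd (fun U hU => by
    obtain ⟨N, hN⟩ := hV.mem_iff.mp hU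
    filter_upwards [eventually_ge_atTop N] with j hj
    exact (hVcd j).trans ((hV.antitone hj).trans hN)) hdisj
  obtain ⟨C, hC⟩ := hk f hf
  obtain ⟨j, hj⟩ := pow_unbounded_of_one_lt C (one_lt_two : (1 : ℝ) < 2)
  obtain ⟨H, hH⟩ := (hk' (s j) (hs j).1 (n j)).exists_isPrim hab
  have h1 : IsPrim (c j) (d j) (fun x => (1 / 2) ^ j * (s j x * k (n j) x))
      fun x => (1 / 2) ^ j * H x :=
    IsPrimOn.const_mul _ (hH.mono_interval (hcd j).1 (hcd j).2.2)
  have h2 : IsPrim (c j) (d j) (fun x => f x * k (n j) x) fun x => (1 / 2) ^ j * H x := by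
    refine h1.congr_ae ?_
    filter_upwards [ae_coe_ne (c j), ae_coe_ne (d j)] with x hx1 hx2 hx
    rw [hfeq j x ⟨lt_of_le_of_ne hx.1 hx1.symm, lt_of_le_of_ne hx.2 hx2⟩]
    ring
  have h3 := (hC (n j)).2 _ _ (hcd j).1 (hcd j).2.1 (hcd j).2.2
  have h4 := hlarge j
  rw [h2.hkIntegral le_rfl (hcd j).2.1 le_rfl, ← mul_sub, abs_mul,
    abs_of_pos (by positivity)] at h3
  rw [hH.hkIntegral (hcd j).1 (hcd j).2.1 (hcd j).2.2] at h4
  have h5 : (1 / 2 : ℝ) ^ j * 4 ^ j < (1 / 2) ^ j * |H (d j) - H (c j)| :=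
    mul_lt_mul_of_pos_left h4 (by positivity)
  rw [← mul_pow] at h5
  norm_num at h5 h3
  linarith

/-- A sequence of functions that multiplies every integrable function into a norm-bounded
sequence is uniformly bounded as a sequence of multipliers. -/
theorem exists_uniform_multiplier_bound {a b : EReal} (hab : a ≤ b) {k : ℕ → ℝ → ℝ}
    (hk : ∀ f, HKIntegrable a b f → ∃ C, ∀ n, AlexiewiczLe a b (fun x => f x * k n x) C) :
    ∃ M : ℝ, ∀ n s, AlexiewiczLe a b s 1 → AlexiewiczLe a b (fun x => s x * k n x) M := by
  have hk' : ∀ f, HKIntegrable a b f → ∀ n, HKIntegrable a b fun x => f x * k n x :=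
    fun f hf n => let ⟨_, hC⟩ := hk f hf; (hC n).1
  choose U hU hUm using exists_nhds_uniformMultiplierOn hab hk
  obtain ⟨γ, hγ, hγU⟩ := exists_gauge_subset hU
  -- Only the chain of intervals matters here, not the zero sum: it is a finite cover on whose
  -- pieces the local bounds hold, and these bounds add.
  obtain ⟨r, hr⟩ := exists_fineSum (fun _ => 0) hγ hab
  have key : ∀ v r, FineSum (fun _ => 0) γ a v r → v ≤ b →
      UniformMultiplierOn a b k (Icc a v) := by
    intro v r hr
    induction hr with
    | nil =>
      intro _
      refine ⟨0, fun n s hs c d hac hcd hdb hsub => ?_⟩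
      have h1 : d = a := le_antisymm (hsub ⟨hcd, le_rfl⟩).2 (hac.trans hcd)
      have h2 : c = a := le_antisymm (h1 ▸ hcd) hac
      obtain ⟨H, hH⟩ := (hk' s hs.1 n).exists_isPrim hab
      rw [hH.hkIntegral hac hcd hdb, h1, h2]
      simp
    | @snoc v w t r h0 h1 h2 h3 ih =>
      intro hw
      have hvw := h1.trans h2
      obtain ⟨M₁, hM₁⟩ := ih (hvw.trans hw)
      obtain ⟨M₂, hM₂⟩ := hUm t
      refine ⟨M₁ + M₂, fun n s hs c d hac hcd hdb hsub => ?_⟩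
      obtain ⟨H, hH⟩ := (hk' s hs.1 n).exists_isPrim hab
      have hdw : d ≤ w := (hsub ⟨hcd, le_rfl⟩).2
      have i1 := hM₁ n s hs (min c v) (min d v) (le_min hac h0.le) (min_le_min hcd le_rfl)
        ((min_le_left _ _).trans hdb) (Icc_subset_Icc (le_min hac h0.le) (min_le_right _ _))
      have i2 := hM₂ n s hs (max c v) (max d v) (hac.trans (le_max_left _ _))
        (max_le_max hcd le_rfl) (max_le hdb (hvw.trans hw))
        ((Icc_subset_Icc (le_max_right _ _) (max_le hdw hvw)).trans
          (h3.trans (hγU t)))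
      rw [hH.hkIntegral (le_min hac h0.le) (min_le_min hcd le_rfl)
        ((min_le_left _ _).trans hdb)] at i1
      rw [hH.hkIntegral (hac.trans (le_max_left _ _)) (max_le_max hcd le_rfl)
        (max_le hdb (hvw.trans hw))] at i2
      -- Splits an increment of H at v uniformly, wherever c and d lie relative to v.
      have e : ∀ x, H x = H (min x v) + H (max x v) - H v := fun x => by
        rcases le_total x v with h | h
        · rw [min_eq_left h, max_eq_right h]; ring
        · rw [min_eq_right h, max_eq_left h]; ring
      rw [hH.hkIntegral hac hcd hdb, e c, e d]
      rw [abs_le] at *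
      constructor <;> linarith
  obtain ⟨M, hM⟩ := key b r hr le_rfl
  exact ⟨M, fun n s hs => ⟨hk' s hs.1 n, fun c d hac hcd hdb =>
    hM n s hs c d hac hcd hdb (Icc_subset_Icc hac hdb)⟩⟩

/-! ### Averages of multipliers and their variation -/

theorem isPrim_one (c d : ℝ) : IsPrim c d (fun _ => 1) EReal.toReal := by
  intro ε hε
  refine ⟨fun _ => 0, monotone_const, fun _ => ⟨le_rfl, hε.le⟩, fun t _ => ?_⟩
  induction t with
  | bot => rw [prod_nhdsWithin_Icc_eq_bot (by simp)]; exact eventually_bot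
  | top => rw [prod_nhdsWithin_Icc_eq_bot (by simp)]; exact eventually_bot
  | coe x => simp [fext_coe]

/-- The normalised indicator function of `(x - δ, x + δ)`. -/
noncomputable def bump (x δ : ℝ) : ℝ → ℝ := fun y =>
  (2 * δ)⁻¹ * {y : ℝ | (y : EReal) ∈ Ioo ((x - δ : ℝ) : EReal) ((x + δ : ℝ) : EReal)}.indicator
    (fun _ => 1) y

/-- The primitive of `bump x δ`. -/
noncomputable def ramp (x δ : ℝ) : EReal → ℝ := fun y =>
  (2 * δ)⁻¹ * (max ((x - δ : ℝ) : EReal) (min y ((x + δ : ℝ) : EReal))).toReal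
    + (-(2 * δ)⁻¹) * (x - δ)

theorem isPrim_bump (a b : EReal) {x δ : ℝ} (hδ : 0 < δ) :
    IsPrim a b (bump x δ) (ramp x δ) := by
  have h1 := IsPrimOn.const_mul (2 * δ)⁻¹ ((isPrim_one (x - δ) (x + δ)).indicator
    (by norm_cast; linarith) a b)
  refine IsPrimOn.of_locally_eq h1 fun t _ _ => ⟨mem_univ t, rfl, ?_⟩
  filter_upwards [self_mem_nhdsWithin] with y hy
  exact ⟨hy, by unfold ramp; ring⟩

theorem toReal_clamp {c d : ℝ} (hcd : c ≤ d) (y : EReal) :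
    (max (c : EReal) (min y d)).toReal ∈ Icc c d := by
  have h1 : (c : EReal) ≤ max (c : EReal) (min y d) := le_max_left _ _
  have h2 : max (c : EReal) (min y d) ≤ d := max_le (by exact_mod_cast hcd) (min_le_right _ _)
  generalize max (c : EReal) (min y d) = w at *
  induction w with
  | bot => simp at h1
  | top => simp at h2
  | coe w => exact ⟨by exact_mod_cast h1, by exact_mod_cast h2⟩

theorem ramp_mem_Icc {x δ : ℝ} (hδ : 0 < δ) (y : EReal) : ramp x δ y ∈ Icc (0 : ℝ) 1 := by
  have h := toReal_clamp (show x - δ ≤ x + δ by linarith) y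
  have e : ramp x δ y = ((max ((x - δ : ℝ) : EReal) (min y ((x + δ : ℝ) : EReal))).toReal
      - (x - δ)) / (2 * δ) := by
    unfold ramp; rw [div_eq_inv_mul]; ring
  rw [e]
  exact ⟨div_nonneg (by linarith [h.1]) (by linarith),
    (div_le_one (by linarith)).mpr (by linarith [h.2])⟩

/-- Makes sums of differences of ramps with increasing centres telescope. -/
theorem ramp_anti {x x' δ : ℝ} (hδ : 0 < δ) (hx : x ≤ x') (y : EReal) :
    ramp x' δ y ≤ ramp x δ y := by
  induction y with
  | bot =>
    unfold ramp
    rw [min_eq_left bot_le, min_eq_left bot_le, max_eq_left bot_le, max_eq_left bot_le,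
      EReal.toReal_coe, EReal.toReal_coe]
    linarith
  | top =>
    have e : ∀ x : ℝ, max ((x - δ : ℝ) : EReal) ((x + δ : ℝ) : EReal) = ((x + δ : ℝ) : EReal) :=
      fun x => max_eq_right (by norm_cast; linarith)
    unfold ramp
    rw [min_eq_right le_top, min_eq_right le_top, e, e, EReal.toReal_coe, EReal.toReal_coe]
    linarith
  | coe y =>
    have e : ∀ x : ℝ, ramp x δ y = (2 * δ)⁻¹ * max 0 (min (y - x + δ) (2 * δ)) := by
      intro x
      have e1 : max ((x - δ : ℝ) : EReal) (min (y : EReal) ((x + δ : ℝ) : EReal)) =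
        ((max (x - δ) (min y (x + δ)) : ℝ) : EReal) := by
          rw [EReal.coe_strictMono.monotone.map_max, EReal.coe_strictMono.monotone.map_min]
      have e2 : max (x - δ) (min y (x + δ)) = max 0 (min (y - x + δ) (2 * δ)) + (x - δ) := by
        rw [← max_add_add_right, ← min_add_add_right]; ring_nf
      unfold ramp
      rw [e1, EReal.toReal_coe, e2]; ring
    rw [e, e]
    refine mul_le_mul_of_nonneg_left (max_le_max le_rfl (min_le_min (by linarith) le_rfl)) ?_
    positivity

theorem hkIntegral_bump_mul {a b c d : EReal} {k : ℝ → ℝ} {K : EReal → ℝ} (hK : IsPrim c d k K)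
    (hac : a ≤ c) (hdb : d ≤ b) {x δ : ℝ} (hδ : 0 < δ) (hcx : c ≤ ((x - δ : ℝ) : EReal))
    (hxd : ((x + δ : ℝ) : EReal) ≤ d) :
    hkIntegral a b (fun y => bump x δ y * k y) =
      (K ((x + δ : ℝ) : EReal) - K ((x - δ : ℝ) : EReal)) / (2 * δ) := by
  have hle : ((x - δ : ℝ) : EReal) ≤ ((x + δ : ℝ) : EReal) := by norm_cast; linarith
  have h1 := IsPrimOn.const_mul (2 * δ)⁻¹ ((hK.mono_interval hcx hxd).indicator hle a b)
  have e : (fun y => (2 * δ)⁻¹ * {y : ℝ | (y : EReal) ∈ Ioo ((x - δ : ℝ) : EReal)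
      ((x + δ : ℝ) : EReal)}.indicator k y) = fun y => bump x δ y * k y := by
    ext y
    unfold bump
    by_cases hy : y ∈ {y : ℝ | (y : EReal) ∈ Ioo ((x - δ : ℝ) : EReal) ((x + δ : ℝ) : EReal)}
    · rw [indicator_of_mem hy, indicator_of_mem hy]; ring
    · rw [indicator_of_notMem hy, indicator_of_notMem hy]; ring
  rw [e] at h1
  have h2 : a ≤ ((x - δ : ℝ) : EReal) := hac.trans hcx
  have h3 : ((x + δ : ℝ) : EReal) ≤ b := hxd.trans hdb
  rw [IsPrim.hkIntegral h1 le_rfl (h2.trans (hle.trans h3)) le_rfl, min_eq_right h3,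
    max_eq_right hle, max_eq_left ((min_le_left _ _).trans h2)]
  rw [div_eq_inv_mul]; ring

/-- Test against the indicator of (p, q). The endpoints are finite because the constant 1 is not
integrable over an unbounded interval. -/
theorem exists_isPrim_of_multiplier {a b : EReal} {k : ℝ → ℝ}
    (hk : ∀ f, HKIntegrable a b f → HKIntegrable a b fun x => f x * k x) {p q : ℝ}
    (hpq : p ≤ q) (hap : a ≤ p) (hqb : q ≤ b) : ∃ K, IsPrim p q k K := by
  have hpq' : (p : EReal) ≤ q := by exact_mod_cast hpq
  have h1 := (isPrim_one p q).indicator hpq' a b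
  obtain ⟨K, hK⟩ := (hk _ (h1.hkIntegrable le_rfl le_rfl)).exists_isPrim (hap.trans (hpq'.trans hqb))
  refine ⟨K, (hK.mono_interval hap hqb).congr_ae ?_⟩
  filter_upwards [ae_coe_ne p, ae_coe_ne q] with x hx1 hx2 hx
  rw [indicator_of_mem, one_mul]
  exact ⟨lt_of_le_of_ne hx.1 hx1.symm, lt_of_le_of_ne hx.2 hx2⟩

/-- Almost everywhere, a multiplier is the limit of its averages. -/
theorem ae_tendsto_hkIntegral_bump_mul {a b : EReal} {k : ℝ → ℝ}
    (hk : ∀ f, HKIntegrable a b f → HKIntegrable a b fun x => f x * k x) :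
    ∀ᵐ x : ℝ, (x : EReal) ∈ Ioo a b →
      Tendsto (fun δ => hkIntegral a b fun y => bump x δ y * k y) (𝓝[>] 0) (𝓝 (k x)) := by
  -- Rational endpoints leave countably many null sets to discard.
  have key : ∀ᵐ x : ℝ, ∀ p q : ℚ, a < ((p : ℝ) : EReal) → ((q : ℝ) : EReal) < b →
      (p : ℝ) < x → x < q →
      Tendsto (fun δ => hkIntegral a b fun y => bump x δ y * k y) (𝓝[>] 0) (𝓝 (k x)) := by
    rw [ae_all_iff]; intro p
    rw [ae_all_iff]; intro q
    by_cases hpq : (p : ℝ) ≤ q ∧ a < ((p : ℝ) : EReal) ∧ ((q : ℝ) : EReal) < b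
    · obtain ⟨hpq, hap, hqb⟩ := hpq
      obtain ⟨K, hK⟩ := exists_isPrim_of_multiplier hk hpq hap.le hqb.le
      filter_upwards [hK.ae_tendsto_symmetric_quotient] with x hx _ _ hpx hxq
      refine (hx ⟨by exact_mod_cast hpx, by exact_mod_cast hxq⟩).congr' ?_
      have hI : Ioo 0 (min (x - p) (q - x)) ∈ 𝓝[>] (0 : ℝ) :=
        Ioo_mem_nhdsGT (lt_min (by linarith) (by linarith))
      filter_upwards [hI] with δ hδ
      have h1 := hδ.2.trans_le (min_le_left _ _)
      have h2 := hδ.2.trans_le (min_le_right _ _)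
      exact (hkIntegral_bump_mul hK hap.le hqb.le hδ.1 (by norm_cast; linarith)
        (by norm_cast; linarith)).symm
    · refine Eventually.of_forall fun x h1 h2 h3 h4 => absurd ⟨?_, h1, h2⟩ hpq
      linarith
  filter_upwards [key] with x hx hxm
  obtain ⟨p, hp1, hp2⟩ := EReal.lt_iff_exists_rat_btwn.mp hxm.1
  obtain ⟨q, hq1, hq2⟩ := EReal.lt_iff_exists_rat_btwn.mp hxm.2
  exact hx p q hp1 hq2 (by exact_mod_cast hp2) (by exact_mod_cast hq1)

theorem alexiewiczLe_bump {a b : EReal} {x δ : ℝ} (hδ : 0 < δ) :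
    AlexiewiczLe a b (bump x δ) 1 := by
  refine ⟨(isPrim_bump a b hδ).hkIntegrable le_rfl le_rfl, fun c d hac hcd hdb => ?_⟩
  rw [(isPrim_bump a b hδ).hkIntegral hac hcd hdb, abs_le]
  have h1 := ramp_mem_Icc (x := x) hδ c
  have h2 := ramp_mem_Icc (x := x) hδ d
  constructor <;> linarith [h1.1, h1.2, h2.1, h2.2]

/-- Apply the multiplier to the sum of ±1/2 times differences of consecutive bumps, with signs
making every term positive. Its primitive telescopes to at most 1/2 in modulus, so its norm is at
most 1 however many bumps are used. -/
theorem sum_abs_sub_hkIntegral_bump_le {a b : EReal} (hab : a ≤ b) {k : ℝ → ℝ} {M : ℝ}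
    (hM : ∀ s, AlexiewiczLe a b s 1 → AlexiewiczLe a b (fun x => s x * k x) M)
    {x : ℕ → ℝ} (hx : Monotone x) (m : ℕ) {δ : ℝ} (hδ : 0 < δ) :
    ∑ i ∈ Finset.range m, |hkIntegral a b (fun y => bump (x (i + 1)) δ y * k y) -
      hkIntegral a b (fun y => bump (x i) δ y * k y)| ≤ 2 * M := by
  set A : ℕ → ℝ := fun i => hkIntegral a b (fun y => bump (x i) δ y * k y) with hA
  choose H hH using fun i =>
    (hM _ (alexiewiczLe_bump (a := a) (b := b) (x := x i) hδ)).1.exists_isPrim hab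
  have hAH : ∀ i, A i = H i b - H i a := fun i => (hH i).hkIntegral le_rfl hab le_rfl
  obtain ⟨w, hw, hwA⟩ : ∃ w : ℕ → ℝ, (∀ i, |w i| ≤ 1 / 2) ∧
      ∀ i, w i * (A (i + 1) - A i) = |A (i + 1) - A i| / 2 := by
    refine ⟨fun i => if 0 ≤ A (i + 1) - A i then 1 / 2 else -(1 / 2), fun i => ?_, fun i => ?_⟩
    · dsimp only; split_ifs <;> norm_num [abs_of_pos]
    · dsimp only; split_ifs with h
      · rw [abs_of_nonneg h]; ring
      · rw [abs_of_neg (not_le.mp h)]; ring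
  have hS : IsPrim a b (fun y => ∑ i ∈ Finset.range m,
      (w i * bump (x (i + 1)) δ y + (-w i) * bump (x i) δ y))
      (fun y => ∑ i ∈ Finset.range m,
        (w i * ramp (x (i + 1)) δ y + (-w i) * ramp (x i) δ y)) :=
    IsPrimOn.sum _ fun i _ => IsPrimOn.add (IsPrimOn.const_mul _ (isPrim_bump a b hδ))
      (IsPrimOn.const_mul _ (isPrim_bump a b hδ))
  have hSb : ∀ y, |∑ i ∈ Finset.range m,
      (w i * ramp (x (i + 1)) δ y + (-w i) * ramp (x i) δ y)| ≤ 1 / 2 := by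
    intro y
    calc _ ≤ ∑ i ∈ Finset.range m,
          |w i * ramp (x (i + 1)) δ y + (-w i) * ramp (x i) δ y| := Finset.abs_sum_le_sum_abs _ _
      _ ≤ ∑ i ∈ Finset.range m, 1 / 2 * (ramp (x i) δ y - ramp (x (i + 1)) δ y) := by
          refine Finset.sum_le_sum fun i _ => ?_
          have h1 := ramp_anti hδ (hx (Nat.le_succ i)) y
          have e : w i * ramp (x (i + 1)) δ y + (-w i) * ramp (x i) δ y =
            -(w i * (ramp (x i) δ y - ramp (x (i + 1)) δ y)) := by ring
          rw [e, abs_neg, abs_mul, abs_of_nonneg (sub_nonneg.mpr h1)]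
          exact mul_le_mul_of_nonneg_right (hw i) (sub_nonneg.mpr h1)
      _ = 1 / 2 * (ramp (x 0) δ y - ramp (x m) δ y) := by
          rw [← Finset.mul_sum, Finset.sum_range_sub']
      _ ≤ 1 / 2 := by
          linarith [(ramp_mem_Icc (x := x 0) hδ y).2, (ramp_mem_Icc (x := x m) hδ y).1]
  have hs1 : AlexiewiczLe a b (fun y => ∑ i ∈ Finset.range m,
      (w i * bump (x (i + 1)) δ y + (-w i) * bump (x i) δ y)) 1 := by
    refine ⟨hS.hkIntegrable le_rfl le_rfl, fun c d hac hcd hdb => ?_⟩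
    rw [hS.hkIntegral hac hcd hdb]
    refine (abs_sub _ _).trans ?_
    linarith [hSb c, hSb d]
  have hT : IsPrim a b (fun y => (∑ i ∈ Finset.range m,
      (w i * bump (x (i + 1)) δ y + (-w i) * bump (x i) δ y)) * k y)
      (fun y => ∑ i ∈ Finset.range m, (w i * H (i + 1) y + (-w i) * H i y)) := by
    have := IsPrimOn.sum (Finset.range m) fun i _ =>
      IsPrimOn.add (IsPrimOn.const_mul (w i) (hH (i + 1))) (IsPrimOn.const_mul (-w i) (hH i))
    have e : (fun y => (∑ i ∈ Finset.range m,
        (w i * bump (x (i + 1)) δ y + (-w i) * bump (x i) δ y)) * k y) =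
        fun y => ∑ i ∈ Finset.range m, (w i * (bump (x (i + 1)) δ y * k y) +
          (-w i) * (bump (x i) δ y * k y)) := by
      ext y
      rw [Finset.sum_mul]
      exact Finset.sum_congr rfl fun i _ => by ring
    unfold IsPrim
    rw [e]
    exact this
  have h1 := (hM _ hs1).2 a b le_rfl hab le_rfl
  rw [hT.hkIntegral le_rfl hab le_rfl, ← Finset.sum_sub_distrib] at h1
  have h2 : ∑ i ∈ Finset.range m, (w i * H (i + 1) b + -w i * H i b -
      (w i * H (i + 1) a + -w i * H i a)) = ∑ i ∈ Finset.range m, |A (i + 1) - A i| / 2 := by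
    refine Finset.sum_congr rfl fun i _ => ?_
    rw [← hwA, hAH, hAH]; ring
  rw [h2, ← Finset.sum_div] at h1
  have := (abs_le.mp h1).2
  linarith

/-- A bounded multiplier has bounded variation outside of a null set. -/
theorem exists_set_eVariationOn_le {a b : EReal} (hab : a ≤ b) {k : ℝ → ℝ} {M : ℝ}
    (hk : ∀ f, HKIntegrable a b f → HKIntegrable a b fun x => f x * k x)
    (hM : ∀ s, AlexiewiczLe a b s 1 → AlexiewiczLe a b (fun x => s x * k x) M) :
    ∃ D : Set EReal, D ⊆ Ioo a b ∧ (∀ᵐ x : ℝ, (x : EReal) ∈ Ioo a b → (x : EReal) ∈ D) ∧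
      (∀ x ∈ D, ∃ y : ℝ, x = y) ∧ (∀ x ∈ D, |k x.toReal| ≤ M) ∧
      eVariationOn (fun x : EReal => k x.toReal) D ≤ ENNReal.ofReal (2 * M) := by
  -- D consists of the points where the averages converge to k; bounds on the averages pass to the
  -- limit there.
  refine ⟨{x | ∃ y : ℝ, x = y ∧ (y : EReal) ∈ Ioo a b ∧
    Tendsto (fun δ => hkIntegral a b fun z => bump y δ z * k z) (𝓝[>] 0) (𝓝 (k y))},
    ?_, ?_, ?_, ?_, ?_⟩
  · rintro _ ⟨y, rfl, hy, -⟩; exact hy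
  · filter_upwards [ae_tendsto_hkIntegral_bump_mul hk] with x hx hxm
    exact ⟨x, rfl, hxm, hx hxm⟩
  · rintro x ⟨y, hy, -⟩; exact ⟨y, hy⟩
  · rintro _ ⟨y, rfl, hy, ht⟩
    rw [EReal.toReal_coe]
    refine le_of_tendsto ht.abs ?_
    filter_upwards [self_mem_nhdsWithin] with δ hδ
    exact (hM _ (alexiewiczLe_bump hδ)).2 a b le_rfl hab le_rfl
  · refine iSup_le ?_
    rintro ⟨m, u, hu, huD⟩
    have huD' := huD
    choose x hx hxm hxt using huD'
    have hxmono : Monotone x := fun i j hij => by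
      have := hu hij; rw [hx, hx] at this; exact_mod_cast this
    have h1 : ∑ i ∈ Finset.range m, |k (x (i + 1)) - k (x i)| ≤ 2 * M := by
      refine le_of_tendsto (tendsto_finsetSum (Finset.range m) fun i _ =>
        ((hxt (i + 1)).sub (hxt i)).abs) ?_
      filter_upwards [self_mem_nhdsWithin] with δ hδ
      exact sum_abs_sub_hkIntegral_bump_le hab hM hxmono m hδ
    refine le_trans (le_of_eq ?_) (ENNReal.ofReal_le_ofReal h1)
    rw [ENNReal.ofReal_sum_of_nonneg fun _ _ => abs_nonneg _]
    refine Finset.sum_congr rfl fun i _ => ?_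
    rw [edist_dist, Real.dist_eq]
    dsimp only
    rw [hx, hx, EReal.toReal_coe, EReal.toReal_coe]

/-! ### Normalised representatives -/

theorem eVariationOn_le_add_of_edist_le {α : Type*} [LinearOrder α] {f p q : α → ℝ} {s : Set α}
    (h : ∀ x ∈ s, ∀ y ∈ s, edist (f x) (f y) ≤ edist (p x) (p y) + edist (q x) (q y)) :
    eVariationOn f s ≤ eVariationOn p s + eVariationOn q s := by
  refine iSup_le ?_
  rintro ⟨n, u, hu, us⟩
  calc _ ≤ ∑ i ∈ Finset.range n, (edist (p (u (i + 1))) (p (u i)) +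
        edist (q (u (i + 1))) (q (u i))) := Finset.sum_le_sum fun i _ => h _ (us _) _ (us _)
    _ = _ := Finset.sum_add_distrib
    _ ≤ _ := add_le_add (eVariationOn.sum_le hu us) (eVariationOn.sum_le hu us)

theorem eVariationOn_sub_le {α : Type*} [LinearOrder α] (p q : α → ℝ) (s : Set α) :
    eVariationOn (fun x => p x - q x) s ≤ eVariationOn p s + eVariationOn q s :=
  eVariationOn_le_add_of_edist_le fun x _ y _ => by
    simpa only [sub_eq_add_neg, edist_neg_neg] using edist_add_add_le (p x) (-q x) (p y) (-q y)

theorem eVariationOn_add_le {α : Type*} [LinearOrder α] (p q : α → ℝ) (s : Set α) :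
    eVariationOn (fun x => p x + q x) s ≤ eVariationOn p s + eVariationOn q s :=
  eVariationOn_le_add_of_edist_le fun _ _ _ _ => edist_add_add_le _ _ _ _

theorem Monotone.leftLim_mem_Icc {p : EReal → ℝ} (hp : Monotone p) {B : ℝ}
    (hB : ∀ x, p x ∈ Icc (-B) B) (x : EReal) : Function.leftLim p x ∈ Icc (-B) B := by
  refine ⟨?_, (hp.leftLim_le le_rfl).trans (hB x).2⟩
  rcases eq_or_ne x ⊥ with rfl | hx
  · rw [leftLim_eq_of_eq_bot p (by simp)]; exact (hB _).1
  · exact (hB ⊥).1.trans (hp.le_leftLim (bot_lt_iff_ne_bot.mpr hx))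

theorem Monotone.ae_leftLim_coe_eq {p : EReal → ℝ} (hp : Monotone p) :
    ∀ᵐ x : ℝ, Function.leftLim p x = p x := by
  have hc : {x : ℝ | ¬ ContinuousAt p x}.Countable :=
    (hp.countable_not_continuousAt.preimage EReal.coe_injective)
  filter_upwards [hc.ae_notMem volume] with x hx
  have hx' : ContinuousAt p x := not_not.mp hx
  exact hp.continuousWithinAt_Iio_iff_leftLim_eq.mp hx'.continuousWithinAt

theorem Monotone.continuousWithinAt_leftLim {p : EReal → ℝ} (hp : Monotone p) {B : ℝ}
    (hB : ∀ x, p x ∈ Icc (-B) B) (x : EReal) :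
    ContinuousWithinAt (Function.leftLim p) (Iic x) x :=
  BoundedVariationOn.continuousWithinAt_leftLim
    ((hp.monotoneOn univ).boundedVariationOn (C := B) fun y _ => abs_le.mpr (hB y))

theorem exists_monotone_bounded_extension {p : EReal → ℝ} {D : Set EReal} (hp : MonotoneOn p D)
    {B : ℝ} (hB0 : 0 ≤ B) (hB : ∀ x ∈ D, |p x| ≤ B) :
    ∃ q : EReal → ℝ, Monotone q ∧ (∀ x, q x ∈ Icc (-B) B) ∧ ∀ x ∈ D, q x = p x := by
  obtain ⟨q, hq, hqp⟩ := hp.exists_monotone_extension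
    ⟨-B, by rintro _ ⟨x, hx, rfl⟩; exact (abs_le.mp (hB x hx)).1⟩
    ⟨B, by rintro _ ⟨x, hx, rfl⟩; exact (abs_le.mp (hB x hx)).2⟩
  refine ⟨fun x => max (-B) (min (q x) B), fun x y hxy =>
    max_le_max le_rfl (min_le_min (hq hxy) le_rfl),
    fun x => ⟨le_max_left _ _, max_le (by linarith) (min_le_right _ _)⟩, fun x hx => ?_⟩
  have h1 := abs_le.mp (hB x hx)
  dsimp only
  rw [← hqp hx, min_eq_left h1.2, max_eq_right h1.1]

/-- A function that is bounded and of bounded variation on a set of full measure has a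
normalised version. -/
theorem exists_isNBV_ae_eq {a b : EReal} (hab : a < b) {D : Set EReal}
    (hDae : ∀ᵐ x : ℝ, (x : EReal) ∈ Ioo a b → (x : EReal) ∈ D) {φ : EReal → ℝ} {V C : ℝ}
    (hV0 : 0 ≤ V) (hC0 : 0 ≤ C) (hV : eVariationOn φ D ≤ ENNReal.ofReal V)
    (hC : ∀ x ∈ D, |φ x| ≤ C) :
    ∃ h, IsNBV a b h ∧ (∀ᵐ x : ℝ, (x : EReal) ∈ Icc a b → φ x = h x) ∧
      eVariationOn h (Icc a b) ≤ ENNReal.ofReal (4 * (V + C)) := by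
  have hVt : BoundedVariationOn φ D := ne_top_of_le_ne_top ENNReal.ofReal_ne_top hV
  have hl := hVt.locallyBoundedVariationOn
  obtain ⟨p, q, hp, hq, hpb, hqb, hpq⟩ : ∃ p q : EReal → ℝ, MonotoneOn p D ∧ MonotoneOn q D ∧
      (∀ x ∈ D, |p x| ≤ V + C) ∧ (∀ x ∈ D, |q x| ≤ V + C) ∧ ∀ x ∈ D, φ x = p x - q x := by
    rcases D.eq_empty_or_nonempty with rfl | ⟨x₀, hx₀⟩
    · exact ⟨0, 0, by simp [MonotoneOn]⟩
    · have hp := variationOnFromTo.monotoneOn hl hx₀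
      have hq := variationOnFromTo.sub_self_monotoneOn hl hx₀
      have hb : ∀ x ∈ D, |variationOnFromTo φ D x₀ x| ≤ V := by
        intro x _
        have hle : ∀ s ⊆ D, (eVariationOn φ s).toReal ≤ V := fun s hs =>
          ENNReal.toReal_le_of_le_ofReal hV0 ((eVariationOn.mono φ hs).trans hV)
        unfold variationOnFromTo
        split_ifs
        · rw [abs_of_nonneg ENNReal.toReal_nonneg]; exact hle _ inter_subset_left
        · rw [abs_neg, abs_of_nonneg ENNReal.toReal_nonneg]; exact hle _ inter_subset_left
      refine ⟨_, _, hp, hq, fun x hx => (hb x hx).trans (by linarith), fun x hx => ?_,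
        fun x hx => by simp⟩
      exact (abs_sub _ _).trans (add_le_add (hb x hx) (hC x hx))
  set B := V + C with hB
  have hB0 : 0 ≤ B := by positivity
  obtain ⟨P, hP, hPb, hPp⟩ := exists_monotone_bounded_extension hp hB0 hpb
  obtain ⟨Q, hQ, hQb, hQq⟩ := exists_monotone_bounded_extension hq hB0 hqb
  classical
  have ha : a ∈ Icc a b := ⟨le_rfl, hab.le⟩
  have hb : b ∈ Icc a b := ⟨hab.le, le_rfl⟩
  -- Adding B makes the left limit nonnegative, so setting the value 0 at a keeps monotonicity. The
  -- shift cancels in P - Q, and each part varies by at most 2 B.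
  have hmono : ∀ R : EReal → ℝ, Monotone R → (∀ x, R x ∈ Icc (-B) B) →
      eVariationOn (fun x => if x ≤ a then 0 else Function.leftLim R x + B) (Icc a b) ≤
        ENNReal.ofReal (2 * B) := by
    intro R hR hRb
    have h1 : MonotoneOn (fun x => if x ≤ a then 0 else Function.leftLim R x + B) (Icc a b) := by
      intro x _ y _ hxy
      have h2 := (hR.leftLim_mem_Icc hRb y).1
      by_cases hya : y ≤ a
      · simp [hya, hxy.trans hya]
      · by_cases hxa : x ≤ a
        · simp only [hya, hxa, if_true, if_false]; linarith
        · simp only [hya, hxa, if_false]; linarith [hR.leftLim hxy]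
    have h3 := h1.eVariationOn_eq ha hb
    rw [inter_self] at h3
    rw [h3]
    refine ENNReal.ofReal_le_ofReal ?_
    simp only [le_refl, if_true, not_le.mpr hab, if_false]
    linarith [(hR.leftLim_mem_Icc hRb b).2]
  set h : EReal → ℝ := fun x => (if x ≤ a then 0 else Function.leftLim P x + B) -
    (if x ≤ a then 0 else Function.leftLim Q x + B) with hh
  have hvar : eVariationOn h (Icc a b) ≤ ENNReal.ofReal (4 * B) := by
    refine (eVariationOn_sub_le _ _ _).trans ((add_le_add (hmono P hP hPb) (hmono Q hQ hQb)).trans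
      (le_of_eq ?_))
    rw [← ENNReal.ofReal_add (by positivity) (by positivity)]
    ring_nf
  have hha : ∀ x, a < x → h x = Function.leftLim P x - Function.leftLim Q x := fun x hx => by
    simp [hh, not_le.mpr hx]
  refine ⟨h, ⟨ne_top_of_le_ne_top ENNReal.ofReal_ne_top hvar, fun x hx => ?_, by simp [hh]⟩,
    ?_, hvar⟩
  · refine ((hP.continuousWithinAt_leftLim hPb x).sub
      (hQ.continuousWithinAt_leftLim hQb x)).congr_of_eventuallyEq ?_ (hha x hx.1)
    filter_upwards [nhdsWithin_le_nhds (Ioi_mem_nhds hx.1)] with y hy using hha y hy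
  · filter_upwards [hDae, ae_coe_ne a, ae_coe_ne b, hP.ae_leftLim_coe_eq, hQ.ae_leftLim_coe_eq]
      with x hxD hxa hxb hxP hxQ hx
    have hax := lt_of_le_of_ne hx.1 hxa.symm
    have := hxD ⟨hax, lt_of_le_of_ne hx.2 hxb⟩
    rw [hha _ hax, hxP, hxQ, hPp _ this, hQq _ this, hpq _ this]

/-! ### From small integrals to small measure -/

/-- The integral of T x - T (x - l) reduces to boundary integrals over two intervals of length l;
Markov's inequality finishes. -/
theorem volume_sub_shift_ge_le {T : ℝ → ℝ} (hT : Monotone T) {W : ℝ} (hT0 : ∀ x, 0 ≤ T x)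
    (hTW : ∀ x, T x ≤ W) {c d l ε : ℝ} (hl : 0 ≤ l) (hcd : c + l ≤ d) (hε : 0 < ε) :
    volume {x | x ∈ Ioc (c + l) d ∧ ε ≤ T x - T (x - l)} ≤ ENNReal.ofReal (l * W / ε) := by
  have hTl : Monotone fun x => T (x - l) := fun x y hxy => hT (by linarith)
  have hi : ∀ u v, IntervalIntegrable T volume u v := fun u v => hT.intervalIntegrable
  have hil : ∀ u v, IntervalIntegrable (fun x => T (x - l)) volume u v :=
    fun u v => hTl.intervalIntegrable
  have h1 : ∫ x in (c + l)..d, (T x - T (x - l)) ≤ l * W := by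
    rw [intervalIntegral.integral_sub (hi _ _) (hil _ _), intervalIntegral.integral_comp_sub_right,
      add_sub_cancel_right, intervalIntegral.integral_interval_sub_interval_comm (hi _ _) (hi _ _)
      (hi _ _), intervalIntegral.integral_symm c (c + l), intervalIntegral.integral_symm (d - l) d]
    have h2 : 0 ≤ ∫ x in c..(c + l), T x :=
      intervalIntegral.integral_nonneg (by linarith) fun x _ => hT0 x
    have h3 : ∫ x in (d - l)..d, T x ≤ ∫ _ in (d - l)..d, W :=
      intervalIntegral.integral_mono_on (by linarith) (hi _ _) intervalIntegrable_const
        fun x _ => hTW x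
    rw [intervalIntegral.integral_const, smul_eq_mul] at h3
    linarith
  rw [intervalIntegral.integral_of_le hcd] at h1
  have h4 := mul_meas_ge_le_integral_of_nonneg (μ := volume.restrict (Ioc (c + l) d))
    (f := fun x => T x - T (x - l))
    (Eventually.of_forall fun x => sub_nonneg.mpr (hT (by linarith)))
    ((intervalIntegrable_iff_integrableOn_Ioc_of_le hcd).mp ((hi _ _).sub (hil _ _))) ε
  rw [measureReal_restrict_apply' measurableSet_Ioc] at h4
  rw [inter_comm] at h4
  have h5 : volume.real {x | x ∈ Ioc (c + l) d ∧ ε ≤ T x - T (x - l)} ≤ l * W / ε := by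
    rw [le_div_iff₀ hε, mul_comm]; exact h4.trans h1
  refine ENNReal.le_ofReal_iff_toReal_le ?_ ?_ |>.mpr h5
  · exact ((measure_mono fun x hx => hx.1).trans_lt measure_Ioc_lt_top).ne
  · exact div_nonneg (mul_nonneg hl ((hT0 0).trans (hTW 0))) hε.le

/-- A function of bounded variation with small integrals is small in measure. -/
theorem volume_abs_ge_le_of_hkIntegral_le {c d : ℝ} (hcd : c ≤ d) {h : EReal → ℝ} {W : ℝ}
    (hW0 : 0 ≤ W) (hW : eVariationOn h (Icc (c : EReal) d) ≤ ENNReal.ofReal W) {l ε : ℝ}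
    (hl : 0 < l) (hε : 0 < ε)
    (hη : ∀ u v : EReal, (c : EReal) ≤ u → u ≤ v → v ≤ d →
      |hkIntegral u v fun x => h x| ≤ ε * l / 2) :
    volume {x : ℝ | x ∈ Icc c d ∧ ε ≤ |h x|} ≤ ENNReal.ofReal (l + 6 * l * W / ε) := by
  have hcdE : (c : EReal) ≤ d := by exact_mod_cast hcd
  rcases lt_or_ge d (c + l) with hlt | hle
  · calc _ ≤ volume (Icc c d) := measure_mono fun x hx => hx.1
      _ ≤ _ := by
        rw [Real.volume_Icc]
        refine ENNReal.ofReal_le_ofReal ?_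
        have : 0 ≤ 6 * l * W / ε := by positivity
        linarith
  · have hBV : BoundedVariationOn h (Icc (c : EReal) d) :=
      ne_top_of_le_ne_top ENNReal.ofReal_ne_top hW
    set T : ℝ → ℝ := fun x => (eVariationOn h (Icc (c : EReal) (min x d : ℝ))).toReal with hT
    have hsub : ∀ x : ℝ, Icc (c : EReal) (min x d : ℝ) ⊆ Icc (c : EReal) d := fun x =>
      Icc_subset_Icc_right (by exact_mod_cast min_le_right _ _)
    have hTm : Monotone T := fun x y hxy =>
      ENNReal.toReal_mono (ne_top_of_le_ne_top hBV (eVariationOn.mono h (hsub y)))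
        (eVariationOn.mono h (Icc_subset_Icc_right (by
          exact_mod_cast min_le_min hxy le_rfl)))
    have hTW : ∀ x, T x ≤ W := fun x =>
      ENNReal.toReal_le_of_le_ofReal hW0 ((eVariationOn.mono h (hsub x)).trans hW)
    obtain ⟨H, hH, hHb⟩ := (isPrim_one c d).mul_boundedVariationOn hcdE hBV
    simp only [one_mul] at hH
    -- If |h x| ≥ ε while the integral over [x - l, x] is at most ε l / 2, integration by parts with
    -- F the identity and ω = l gives ε l ≤ ε l / 2 + 3 l V, so h varies by V ≥ ε / 6 there.
    have key : {x : ℝ | x ∈ Icc c d ∧ ε ≤ |h x|} ⊆ Icc c (c + l) ∪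
        {x | x ∈ Ioc (c + l) d ∧ ε / 6 ≤ T x - T (x - l)} := by
      rintro x ⟨hx, hεx⟩
      rcases le_or_gt x (c + l) with h1 | h1
      · exact .inl ⟨hx.1, h1⟩
      · refine .inr ⟨⟨h1, hx.2⟩, ?_⟩
        have hu : (c : EReal) ≤ ((x - l : ℝ) : EReal) := by norm_cast; linarith
        have huv : ((x - l : ℝ) : EReal) ≤ x := by norm_cast; linarith
        have hv : (x : EReal) ≤ d := by exact_mod_cast hx.2
        have h2 := hHb _ _ hu huv hv l fun y hy => by
          obtain ⟨hy1, hy2⟩ := hy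
          induction y with
          | bot => exact absurd hy1 (not_le.mpr (EReal.bot_lt_coe _))
          | top => exact absurd hy2 (not_le.mpr (EReal.coe_lt_top _))
          | coe y =>
            have hy1 : x - l ≤ y := by exact_mod_cast hy1
            have hy2 : y ≤ x := by exact_mod_cast hy2
            rw [EReal.toReal_coe, EReal.toReal_coe, abs_le]
            constructor <;> linarith
        have h3 := hη _ _ hu huv hv
        rw [hH.hkIntegral hu huv hv] at h3
        have hadd := eVariationOn.Icc_add_Icc h (s := univ) hu huv (mem_univ _)
        simp only [univ_inter] at hadd
        have hTd : T x - T (x - l) =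
            (eVariationOn h (Icc ((x - l : ℝ) : EReal) (x : EReal))).toReal := by
          simp only [hT]
          rw [min_eq_left hx.2, min_eq_left (by linarith [hx.2] : x - l ≤ d), ← hadd, ENNReal.toReal_add]
          · ring
          · exact ne_top_of_le_ne_top hBV (eVariationOn.mono h (Icc_subset_Icc_right (huv.trans hv)))
          · exact ne_top_of_le_ne_top hBV (eVariationOn.mono h (Icc_subset_Icc hu hv))
        rw [← hTd, EReal.toReal_coe, EReal.toReal_coe, sub_sub_cancel] at h2
        have h4 : |h x * l| ≤ ε * l / 2 + 3 * l * (T x - T (x - l)) := by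
          have e : h x * l = (H x - H ((x - l : ℝ) : EReal)) -
            (H x - H ((x - l : ℝ) : EReal) - h x * l) := by ring
          rw [e]
          exact (abs_sub _ _).trans (add_le_add h3 h2)
        rw [abs_mul, abs_of_pos hl] at h4
        have h5 : ε * l ≤ |h x| * l := mul_le_mul_of_nonneg_right hεx hl.le
        have h6 : l * (ε / 6) ≤ l * (T x - T (x - l)) := by linarith
        exact le_of_mul_le_mul_left h6 hl
    calc _ ≤ _ := measure_mono key
      _ ≤ _ := measure_union_le _ _
      _ ≤ ENNReal.ofReal l + ENNReal.ofReal (l * W / (ε / 6)) := by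
          refine add_le_add ?_ (volume_sub_shift_ge_le hTm (fun x => ENNReal.toReal_nonneg) hTW
            hl.le hle (by positivity))
          rw [Real.volume_Icc, add_sub_cancel_left]
      _ = _ := by
          rw [← ENNReal.ofReal_add hl.le (by positivity)]
          congr 1; field_simp

/-! ### Necessity of the conditions -/

theorem abs_hkIntegral_le_alexiewiczNorm {a b c d : EReal} {f : ℝ → ℝ} (hac : a ≤ c) (hcd : c ≤ d)
    (hdb : d ≤ b) : ENNReal.ofReal |hkIntegral c d f| ≤ alexiewiczNorm a b f :=
  le_iSup₂_of_le c d (le_iSup_of_le ⟨hac, hcd, hdb⟩ le_rfl)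

theorem HKIntegrable.exists_alexiewiczLe {a b : EReal} (hab : a ≤ b) {f : ℝ → ℝ}
    (h : HKIntegrable a b f) : ∃ C, 0 ≤ C ∧ AlexiewiczLe a b f C := by
  obtain ⟨F, hF⟩ := h.exists_isPrim hab
  obtain ⟨C, hC⟩ := isCompact_Icc.exists_bound_of_continuousOn hF.continuousOn
  have ha := hC a ⟨le_rfl, hab⟩
  refine ⟨2 * C, by linarith [norm_nonneg (F a)], h, fun c d hac hcd hdb => ?_⟩
  have h1 := hC c ⟨hac, hcd.trans hdb⟩
  have h2 := hC d ⟨hac.trans hcd, hdb⟩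
  rw [hF.hkIntegral hac hcd hdb]
  rw [Real.norm_eq_abs] at h1 h2
  refine (abs_sub _ _).trans ?_
  linarith

theorem ProductsConverge.exists_uniform_bound {a b : EReal} (hab : a ≤ b) {gn : ℕ → EReal → ℝ}
    {g : EReal → ℝ} (h : ProductsConverge a b gn g) (f : ℝ → ℝ) (hf : HKIntegrable a b f) :
    ∃ C, ∀ n, AlexiewiczLe a b (fun x : ℝ => f x * (gn n x - g x)) C := by
  obtain ⟨h1, h2⟩ := h f hf
  choose C hC0 hC using fun n => (h1 n).exists_alexiewiczLe hab
  obtain ⟨N, hN⟩ := eventually_atTop.mp (h2.eventually (ge_mem_nhds (zero_lt_one (α := ℝ≥0∞))))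
  -- The tail has norm at most 1; the finitely many earlier bounds are simply added.
  refine ⟨1 + ∑ i ∈ Finset.range N, C i, fun n => ⟨h1 n, fun c d hac hcd hdb => ?_⟩⟩
  have hsum : 0 ≤ ∑ i ∈ Finset.range N, C i := Finset.sum_nonneg fun i _ => hC0 i
  rcases lt_or_ge n N with hn | hn
  · have h3 := (hC n).2 c d hac hcd hdb
    have h4 := Finset.single_le_sum (fun i _ => hC0 i) (Finset.mem_range.mpr hn)
    linarith
  · have h3 := (abs_hkIntegral_le_alexiewiczNorm hac hcd hdb).trans (hN n hn)
    rw [← ENNReal.ofReal_one, ENNReal.ofReal_le_ofReal_iff zero_le_one] at h3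
    linarith

theorem ProductsConverge.equivUniformlyNBV {a b : EReal} (hab : a < b) {gn : ℕ → EReal → ℝ}
    {g : EReal → ℝ} (hg : BoundedVariationOn g (Icc a b)) (h : ProductsConverge a b gn g) :
    EquivUniformlyNBV a b gn := by
  obtain ⟨M, hM⟩ := exists_uniform_multiplier_bound hab.le (k := fun n (x : ℝ) => gn n x - g x)
    (h.exists_uniform_bound hab.le)
  set Vg := (eVariationOn g (Icc a b)).toReal with hVg
  have hVg0 : 0 ≤ Vg := ENNReal.toReal_nonneg
  have hgb : ∀ x ∈ Icc a b, |g x| ≤ |g a| + Vg := fun x hx => by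
    have h1 := hg.dist_le hx (show a ∈ Icc a b from ⟨le_rfl, hab.le⟩)
    rw [Real.dist_eq] at h1
    have h2 := abs_sub_abs_le_abs_sub (g x) (g a)
    linarith
  have key : ∀ n, ∃ hn, IsNBV a b hn ∧ (∀ᵐ x : ℝ, (x : EReal) ∈ Icc a b → gn n x = hn x) ∧
      eVariationOn hn (Icc a b) ≤ ENNReal.ofReal (4 * (2 * |M| + Vg + (|M| + (|g a| + Vg)))) := by
    intro n
    obtain ⟨D, hD, hDae, hDr, hDM, hDV⟩ := exists_set_eVariationOn_le hab.le
      (k := fun x : ℝ => gn n x - g x) (fun f hf => (h f hf).1 n) (hM n)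
    have hcongr : ∀ x ∈ D, gn n x - g x =
        gn n ((x.toReal : ℝ) : EReal) - g ((x.toReal : ℝ) : EReal) := by
      intro x hx
      obtain ⟨y, rfl⟩ := hDr x hx
      rw [EReal.toReal_coe]
    -- Adding g back to the multiplier costs its variation Vg in the variation bound, and |g a| + Vg
    -- in the supremum bound.
    refine exists_isNBV_ae_eq hab hDae (φ := gn n) (by positivity) (by positivity) ?_ ?_
    · have e : EqOn (gn n) (fun x => (gn n ((x.toReal : ℝ) : EReal) -
          g ((x.toReal : ℝ) : EReal)) + g x) D := fun x hx => by
        dsimp only; rw [← hcongr x hx]; ring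
      rw [eVariationOn.congr e]
      refine (eVariationOn_add_le _ _ _).trans ?_
      rw [ENNReal.ofReal_add (by positivity) hVg0]
      refine add_le_add (hDV.trans (ENNReal.ofReal_le_ofReal (by linarith [le_abs_self M]))) ?_
      rw [hVg, ENNReal.ofReal_toReal hg]
      exact eVariationOn.mono g (hD.trans Ioo_subset_Icc_self)
    · intro x hx
      have h1 := hDM x hx
      rw [← hcongr x hx] at h1
      have h2 := hgb x (Ioo_subset_Icc_self (hD hx))
      have h3 : gn n x = (gn n x - g x) + g x := by ring
      rw [h3]
      exact (abs_add_le _ _).trans (add_le_add (h1.trans (le_abs_self M)) h2)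
  choose hn h1 h2 h3 using key
  exact ⟨hn, fun n => ⟨h1 n, h2 n⟩, _, fun n => h3 n⟩

theorem EquivUniformlyNBV.exists_sub {a b : EReal} {gn : ℕ → EReal → ℝ} {g : EReal → ℝ}
    (hg : BoundedVariationOn g (Icc a b)) (h : EquivUniformlyNBV a b gn) :
    ∃ (k : ℕ → EReal → ℝ) (W : ℝ≥0),
      (∀ n, ∀ᵐ x : ℝ, (x : EReal) ∈ Icc a b → gn n x - g x = k n x) ∧
      ∀ n, eVariationOn (k n) (Icc a b) ≤ W := by
  obtain ⟨h, h1, M, hM⟩ := h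
  refine ⟨fun n x => h n x - g x, M + (eVariationOn g (Icc a b)).toNNReal, fun n => ?_,
    fun n => ?_⟩
  · filter_upwards [(h1 n).2] with x hx hxm
    rw [hx hxm]
  · rw [ENNReal.coe_add, ENNReal.coe_toNNReal hg]
    exact (eVariationOn_sub_le _ _ _).trans (add_le_add (hM n) le_rfl)

theorem ProductsConverge.tendsto_volume {a b : EReal} (hab : a < b) {gn : ℕ → EReal → ℝ}
    {g : EReal → ℝ} (hg : BoundedVariationOn g (Icc a b)) (h : ProductsConverge a b gn g)
    {c d : ℝ} (hcd : c ≤ d) (hac : a ≤ c) (hdb : d ≤ b) {ε : ℝ} (hε : 0 < ε) :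
    Tendsto (fun n => volume {x : ℝ | x ∈ Icc c d ∧ ε ≤ |gn n x - g x|}) atTop (𝓝 0) := by
  obtain ⟨k, W, hk, hW⟩ := (h.equivUniformlyNBV hab hg).exists_sub hg
  have hcdE : (c : EReal) ≤ d := by exact_mod_cast hcd
  have hsub : Icc (c : EReal) d ⊆ Icc a b := Icc_subset_Icc hac hdb
  have hvol : ∀ n, volume {x : ℝ | x ∈ Icc c d ∧ ε ≤ |gn n x - g x|} =
      volume {x : ℝ | x ∈ Icc c d ∧ ε ≤ |k n x|} := by
    intro n
    refine measure_congr ?_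
    filter_upwards [hk n] with x hx
    refine propext (and_congr_right fun hxm => ?_)
    rw [hx (hsub ⟨by exact_mod_cast hxm.1, by exact_mod_cast hxm.2⟩)]
  simp only [hvol]
  have h1 := (isPrim_one c d).indicator hcdE a b
  obtain ⟨hi, hlim⟩ := h _ (h1.hkIntegrable le_rfl le_rfl)
  rw [ENNReal.tendsto_nhds_zero]
  intro δ hδ
  -- The window l is fixed first, using the uniform bound W; n then becomes large depending on ε and
  -- l.
  obtain ⟨l, hl, hlδ⟩ : ∃ l : ℝ, 0 < l ∧ ENNReal.ofReal (l + 6 * l * W / ε) ≤ δ := by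
    have ht : Tendsto (fun l : ℝ => ENNReal.ofReal (l + 6 * l * W / ε)) (𝓝[>] 0) (𝓝 0) := by
      have : Continuous fun l : ℝ => ENNReal.ofReal (l + 6 * l * W / ε) :=
        ENNReal.continuous_ofReal.comp (by fun_prop)
      have := this.tendsto 0
      simp only [mul_zero, zero_mul, zero_div, add_zero, ENNReal.ofReal_zero] at this
      exact this.mono_left nhdsWithin_le_nhds
    obtain ⟨l, hl1, hl2⟩ := ((ht.eventually (ge_mem_nhds hδ)).and self_mem_nhdsWithin).exists
    exact ⟨l, hl2, hl1⟩
  have hη : (0 : ℝ≥0∞) < ENNReal.ofReal (ε * l / 2) := ENNReal.ofReal_pos.mpr (by positivity)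
  filter_upwards [hlim.eventually (ge_mem_nhds hη)] with n hn
  refine (volume_abs_ge_le_of_hkIntegral_le hcd W.2 ?_ hl hε fun u v hcu huv hvd => ?_).trans hlδ
  · refine (eVariationOn.mono _ hsub).trans ((hW n).trans (le_of_eq ?_))
    exact (ENNReal.ofReal_coe_nnreal).symm
  · obtain ⟨G, hG⟩ := (hi n).exists_isPrim hab.le
    have hG' : IsPrim c d (fun x => k n x) G := by
      refine (hG.mono_interval hac hdb).congr_ae ?_
      filter_upwards [hk n, ae_coe_ne c, ae_coe_ne d] with x hx hxc hxd hxm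
      rw [indicator_of_mem, one_mul, hx (hsub hxm)]
      exact ⟨lt_of_le_of_ne hxm.1 hxc.symm, lt_of_le_of_ne hxm.2 hxd⟩
    have h3 := (abs_hkIntegral_le_alexiewiczNorm (hac.trans hcu) huv (hvd.trans hdb)).trans hn
    rw [hG.hkIntegral (hac.trans hcu) huv (hvd.trans hdb),
      ENNReal.ofReal_le_ofReal_iff (by positivity)] at h3
    rwa [hG'.hkIntegral hcu huv hvd]

/-! ### Sufficiency of the conditions -/

theorem eventually_exists_abs_lt_of_tendsto_volume {p q : ℝ} (hpq : p < q) {φ κ : ℕ → ℝ → ℝ}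
    {η : ℝ} (h : Tendsto (fun n => volume {x : ℝ | x ∈ Icc p q ∧ η ≤ |φ n x|}) atTop (𝓝 0))
    (hκ : ∀ n, ∀ᵐ x : ℝ, x ∈ Icc p q → φ n x = κ n x) :
    ∀ᶠ n in atTop, ∃ x ∈ Icc p q, |κ n x| < η := by
  have hpos : (0 : ℝ≥0∞) < volume (Icc p q) := by
    rw [Real.volume_Icc]; exact ENNReal.ofReal_pos.mpr (by linarith)
  filter_upwards [h.eventually (gt_mem_nhds hpos)] with n hn
  by_contra! hcon
  refine absurd hn (not_lt.mpr (measure_mono_ae ?_))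
  filter_upwards [hκ n] with x hx hxm
  exact ⟨hxm, by rw [hx hxm]; exact hcon x hxm⟩

/-- If the `k n` have uniformly bounded variation and come close to `0` somewhere in every
interval, then the integrals of `f * k n` tend to `0` uniformly. -/
theorem tendsto_uniform_of_isPrim_mul {a b : EReal} (hab : a ≤ b) {F : EReal → ℝ}
    (hF : ContinuousOn F (Icc a b)) {k H : ℕ → EReal → ℝ} {W : ℝ≥0}
    (hW : ∀ n, eVariationOn (k n) (Icc a b) ≤ W)
    (hH : ∀ n, ∀ u v, a ≤ u → u ≤ v → v ≤ b → ∀ ω : ℝ, (∀ x ∈ Icc u v, |F x - F u| ≤ ω) →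
        |H n v - H n u - k n v * (F v - F u)| ≤ 3 * ω * (eVariationOn (k n) (Icc u v)).toReal)
    (hk : ∀ u v, a ≤ u → u < v → v ≤ b → ∀ η > 0, ∀ᶠ n in atTop, ∃ y ∈ Icc u v, |k n y| < η)
    {ε : ℝ} (hε : 0 < ε) :
    ∀ᶠ n in atTop, ∀ c d, a ≤ c → c ≤ d → d ≤ b → |H n d - H n c| ≤ ε := by
  -- Makes 4 ω (W + 1) = ε / 2; the other half of ε is the error η.
  set ω := ε / (8 * (W + 1)) with hω
  have hω0 : 0 < ω := by positivity
  have hbv : ∀ n, ∀ u v, a ≤ u → v ≤ b → eVariationOn (k n) (Icc u v) ≠ ∞ := fun n u v hu hv =>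
    ne_top_of_le_ne_top ENNReal.coe_ne_top ((eVariationOn.mono _ (Icc_subset_Icc hu hv)).trans (hW n))
  have hclamp : ∀ x ∈ Icc a b, max a (min x b) = x := fun x hx => by
    rw [min_eq_left hx.2, max_eq_right hx.1]
  have hG : Continuous fun x => F (max a (min x b)) :=
    hF.comp_continuous (by fun_prop) fun x => ⟨le_max_left _ _, max_le hab (min_le_right _ _)⟩
  have hU : ∀ t, {x | |F (max a (min x b)) - F (max a (min t b))| < ω / 2} ∈ 𝓝 t := fun t => by
    have := Metric.tendsto_nhds.mp (hG.tendsto t) (ω / 2) (by positivity)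
    simp only [Real.dist_eq] at this
    exact this
  obtain ⟨γ, hγ, hγU⟩ := exists_gauge_subset hU
  obtain ⟨r, hr⟩ := exists_fineSum (fun _ => 0) hγ hab
  have key : ∀ v r, FineSum (fun _ => 0) γ a v r → v ≤ b → ∀ η > 0, ∀ᶠ n in atTop,
      ∀ c d, a ≤ c → c ≤ d → d ≤ v →
        |H n d - H n c| ≤ 4 * ω * (eVariationOn (k n) (Icc a v)).toReal + η := by
    intro v r hr
    induction hr with
    | nil =>
      refine fun _ η hη => Eventually.of_forall fun n c d hac hcd hda => ?_
      have h1 : d = a := le_antisymm hda (hac.trans hcd)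
      have h2 : c = a := le_antisymm (h1 ▸ hcd) hac
      rw [h1, h2, sub_self, abs_zero]
      positivity
    | @snoc v w t r h0 h1 h2 h3 ih =>
      intro hw η hη
      have hvw := h1.trans h2
      have hav := h0.le
      rcases hvw.eq_or_lt with rfl | hlt
      · exact ih hw η hη
      have hosc : ∀ x ∈ Icc v w, ∀ y ∈ Icc v w, |F x - F y| ≤ ω := by
        intro x hx y hy
        have e1 := hγU t (h3 hx)
        have e2 := hγU t (h3 hy)
        rw [mem_ofPred_eq, hclamp x ⟨hav.trans hx.1, hx.2.trans hw⟩] at e1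
        rw [mem_ofPred_eq, hclamp y ⟨hav.trans hy.1, hy.2.trans hw⟩, abs_sub_comm] at e2
        exact (abs_sub_le _ (F (max a (min t b))) _).trans (by linarith)
      filter_upwards [ih (hvw.trans hw) (η / 2) (by positivity),
        hk v w hav hlt hw (η / 2 / ω) (by positivity)] with n hn hy c d hac hcd hdw
      obtain ⟨y, hy, hky⟩ := hy
      rw [lt_div_iff₀ hω0] at hky
      have hadd := eVariationOn.Icc_add_Icc (k n) (s := univ) hav hvw (mem_univ _)
      simp only [univ_inter] at hadd
      have hadd' : (eVariationOn (k n) (Icc a w)).toReal = (eVariationOn (k n) (Icc a v)).toReal +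
          (eVariationOn (k n) (Icc v w)).toReal := by
        rw [← hadd, ENNReal.toReal_add (hbv n _ _ le_rfl (hvw.trans hw)) (hbv n _ _ hav hw)]
      -- Integration by parts contributes 3 ω V, and |k n d| ≤ |k n y| + V contributes ω V plus ω |k
      -- n y| < η / 2.
      have piece : ∀ c d, v ≤ c → c ≤ d → d ≤ w →
          |H n d - H n c| ≤ 4 * ω * (eVariationOn (k n) (Icc v w)).toReal + η / 2 := by
        intro c d hvc hcd hdw
        have i1 := hH n c d (hav.trans hvc) hcd (hdw.trans hw) ω fun x hx =>
          hosc x ⟨hvc.trans hx.1, hx.2.trans hdw⟩ c ⟨hvc, hcd.trans hdw⟩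
        have i2 : (eVariationOn (k n) (Icc c d)).toReal ≤ (eVariationOn (k n) (Icc v w)).toReal :=
          ENNReal.toReal_mono (hbv n _ _ hav hw) (eVariationOn.mono _ (Icc_subset_Icc hvc hdw))
        have i3 : |k n d - k n y| ≤ (eVariationOn (k n) (Icc v w)).toReal := by
          rw [← Real.dist_eq]
          exact BoundedVariationOn.dist_le (hbv n _ _ hav hw) ⟨hvc.trans hcd, hdw⟩ hy
        have i4 := hosc d ⟨hvc.trans hcd, hdw⟩ c ⟨hvc, hcd.trans hdw⟩
        have i5 : |k n d| ≤ |k n y| + (eVariationOn (k n) (Icc v w)).toReal := by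
          linarith [abs_sub_abs_le_abs_sub (k n d) (k n y)]
        have i6 : |k n d * (F d - F c)| ≤
            (|k n y| + (eVariationOn (k n) (Icc v w)).toReal) * ω := by
          rw [abs_mul]
          exact mul_le_mul i5 i4 (abs_nonneg _) (by positivity)
        have i7 : 3 * ω * (eVariationOn (k n) (Icc c d)).toReal ≤
            3 * ω * (eVariationOn (k n) (Icc v w)).toReal :=
          mul_le_mul_of_nonneg_left i2 (by positivity)
        have i8 := abs_add_le (H n d - H n c - k n d * (F d - F c)) (k n d * (F d - F c))
        rw [sub_add_cancel] at i8
        linarith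
      have i1 := hn (min c v) (min d v) (le_min hac hav) (min_le_min hcd le_rfl) (min_le_right _ _)
      have i2 := piece (max c v) (max d v) (le_max_right _ _) (max_le_max hcd le_rfl)
        (max_le hdw hvw)
      have e : ∀ x, H n x = H n (min x v) + H n (max x v) - H n v := fun x => by
        rcases le_total x v with h | h
        · rw [min_eq_left h, max_eq_right h]; ring
        · rw [min_eq_right h, max_eq_left h]; ring
      rw [hadd', e c, e d]
      rw [abs_le] at *
      constructor <;> linarith
  filter_upwards [key b r hr le_rfl (ε / 2) (by positivity)] with n hn c d hac hcd hdb
  refine (hn c d hac hcd hdb).trans ?_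
  have h1 : (eVariationOn (k n) (Icc a b)).toReal ≤ W := ENNReal.toReal_mono ENNReal.coe_ne_top (hW n)
  have h2 : 4 * ω * (eVariationOn (k n) (Icc a b)).toReal ≤ 4 * ω * (W + 1) :=
    mul_le_mul_of_nonneg_left (by linarith) (by positivity)
  have h3 : 4 * ω * (W + 1) = ε / 2 := by rw [hω]; field_simp; norm_num
  linarith

theorem EquivUniformlyNBV.productsConverge {a b : EReal} (hab : a < b) {gn : ℕ → EReal → ℝ}
    {g : EReal → ℝ} (hg : BoundedVariationOn g (Icc a b)) (h : EquivUniformlyNBV a b gn)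
    (hm : ∀ c d : ℝ, c ≤ d → a < c → d < b → ∀ ε > 0,
      Tendsto (fun n => volume {x : ℝ | x ∈ Icc c d ∧ ε ≤ |gn n x - g x|}) atTop (𝓝 0)) :
    ProductsConverge a b gn g := by
  obtain ⟨k, W, hk, hW⟩ := h.exists_sub hg
  intro f hf
  obtain ⟨F, hF⟩ := hf.exists_isPrim hab.le
  choose H hH hHb using fun n => hF.mul_boundedVariationOn hab.le
    (ne_top_of_le_ne_top ENNReal.coe_ne_top (hW n))
  have hH' : ∀ n, IsPrim a b (fun x : ℝ => f x * (gn n x - g x)) (H n) := fun n => by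
    refine (hH n).congr_ae ?_
    filter_upwards [hk n] with x hx hxm
    rw [hx hxm]
  refine ⟨fun n => (hH' n).hkIntegrable le_rfl le_rfl, ENNReal.tendsto_nhds_zero.mpr fun δ hδ => ?_⟩
  obtain ⟨ε, hε0, hεδ⟩ : ∃ ε : ℝ, 0 < ε ∧ ENNReal.ofReal ε ≤ δ := by
    obtain ⟨ε, hε, hεδ⟩ := ENNReal.lt_iff_exists_nnreal_btwn.mp hδ
    exact ⟨ε, by exact_mod_cast hε, by rw [ENNReal.ofReal_coe_nnreal]; exact hεδ.le⟩
  -- Every nondegenerate piece, even one reaching ±∞, contains a compact real interval inside (a,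
  -- b); convergence in measure on such intervals is enough.
  have hsmall := tendsto_uniform_of_isPrim_mul hab.le hF.continuousOn hW hHb (fun u v hu huv hv η hη => by
    obtain ⟨p, hup, hpv⟩ := EReal.lt_iff_exists_real_btwn.mp huv
    obtain ⟨q, hpq, hqv⟩ := EReal.lt_iff_exists_real_btwn.mp hpv
    have hpq' : p < q := by exact_mod_cast hpq
    have hsub : ∀ x ∈ Icc p q, (x : EReal) ∈ Icc u v := fun x hx =>
      ⟨hup.le.trans (by exact_mod_cast hx.1), le_trans (by exact_mod_cast hx.2) hqv.le⟩
    filter_upwards [eventually_exists_abs_lt_of_tendsto_volume hpq'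
      (hm p q hpq'.le (hu.trans_lt hup) (hqv.trans_le hv) η hη) (κ := fun n x => k n x)
      fun n => (hk n).mono fun x hx hxm =>
        hx (Icc_subset_Icc hu hv (hsub x hxm))] with n hn
    obtain ⟨x, hx, hxk⟩ := hn
    exact ⟨x, hsub x hx, hxk⟩) hε0
  filter_upwards [hsmall] with n hn
  refine (iSup₂_le fun c d => iSup_le fun hcd => ?_).trans hεδ
  rw [(hH' n).hkIntegral hcd.1 hcd.2.1 hcd.2.2]
  exact ENNReal.ofReal_le_ofReal (hn c d hcd.1 hcd.2.1 hcd.2.2)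

/-! ### Convergence in measure and the two cases of the theorem -/

theorem tendstoInMeasure_restrict_Icc_iff {c d : ℝ} {φ : ℕ → ℝ → ℝ} {ψ : ℝ → ℝ} :
    TendstoInMeasure (volume.restrict (Icc c d)) φ atTop ψ ↔ ∀ ε > 0,
      Tendsto (fun n => volume {x : ℝ | x ∈ Icc c d ∧ ε ≤ |φ n x - ψ x|}) atTop (𝓝 0) := by
  rw [tendstoInMeasure_iff_norm]
  refine forall₂_congr fun ε _ => ?_
  simp only [Measure.restrict_apply' measurableSet_Icc, Real.norm_eq_abs]
  have : ∀ n, {x | ε ≤ |φ n x - ψ x|} ∩ Icc c d = {x | x ∈ Icc c d ∧ ε ≤ |φ n x - ψ x|} :=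
    fun n => inter_comm _ _
  simp only [this]

theorem tendstoInMeasure_indicator_Icc_iff {c d : ℝ} {φ : ℕ → ℝ → ℝ} {ψ : ℝ → ℝ} :
    TendstoInMeasure volume (fun n => (Icc c d).indicator (φ n)) atTop ((Icc c d).indicator ψ) ↔
      ∀ ε > 0, Tendsto (fun n => volume {x : ℝ | x ∈ Icc c d ∧ ε ≤ |φ n x - ψ x|}) atTop (𝓝 0) := by
  rw [tendstoInMeasure_iff_norm]
  refine forall₂_congr fun ε hε => ?_
  have : ∀ n, {x | ε ≤ ‖(Icc c d).indicator (φ n) x - (Icc c d).indicator ψ x‖} =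
      {x | x ∈ Icc c d ∧ ε ≤ |φ n x - ψ x|} := by
    intro n
    ext x
    by_cases hx : x ∈ Icc c d
    · simp only [mem_ofPred_eq, indicator_of_mem hx, hx, true_and, Real.norm_eq_abs]
    · simp only [mem_ofPred_eq, indicator_of_notMem hx, hx, false_and, sub_self, norm_zero,
        not_le.mpr hε]
  simp only [this]

theorem theorem3 (a b : EReal) (hab : a < b) (gn : ℕ → EReal → ℝ) (g : EReal → ℝ)
    (hg : BoundedVariationOn g (Icc a b)) :
    ((a ≠ ⊥ ∧ b ≠ ⊤) →
      (ProductsConverge a b gn g ↔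
        TendstoInMeasure (volume.restrict {x : ℝ | (x : EReal) ∈ Icc a b})
          (fun n (x : ℝ) => gn n (x : EReal)) atTop (fun x : ℝ => g (x : EReal)) ∧
        EquivUniformlyNBV a b gn)) ∧
    ((a = ⊥ ∨ b = ⊤) →
      (ProductsConverge a b gn g ↔
        (∀ c d : ℝ, a < (c : EReal) → c ≤ d → (d : EReal) < b →
          TendstoInMeasure volume
            (fun n => (Icc c d).indicator (fun x : ℝ => gn n (x : EReal))) atTop
            ((Icc c d).indicator (fun x : ℝ => g (x : EReal)))) ∧
        EquivUniformlyNBV a b gn)) := by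
  constructor
  · rintro ⟨ha, hb⟩
    lift a to ℝ using ⟨(hab.trans_le le_top).ne, ha⟩
    lift b to ℝ using ⟨hb, (bot_le.trans_lt hab).ne'⟩
    have hab' : a < b := by exact_mod_cast hab
    have hset : {x : ℝ | (x : EReal) ∈ Icc (a : EReal) b} = Icc a b := by
      ext x; simp
    rw [hset, tendstoInMeasure_restrict_Icc_iff]
    constructor
    · exact fun h => ⟨fun ε hε => h.tendsto_volume hab hg hab'.le le_rfl le_rfl hε,
        h.equivUniformlyNBV hab hg⟩
    · rintro ⟨h1, h2⟩
      refine h2.productsConverge hab hg fun c d _ hac hdb ε hε => ?_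
      refine tendsto_of_tendsto_of_tendsto_of_le_of_le tendsto_const_nhds (h1 ε hε)
        (fun _ => zero_le) fun n => measure_mono fun x hx => ⟨⟨?_, ?_⟩, hx.2⟩
      · exact le_trans (by exact_mod_cast hac.le) hx.1.1
      · exact hx.1.2.trans (by exact_mod_cast hdb.le)
  · intro _
    simp only [tendstoInMeasure_indicator_Icc_iff]
    constructor
    · exact fun h => ⟨fun c d hac hcd hdb ε hε => h.tendsto_volume hab hg hcd hac.le hdb.le hε,
        h.equivUniformlyNBV hab hg⟩
    · rintro ⟨h1, h2⟩
      exact h2.productsConverge hab hg fun c d hcd hac hdb => h1 c d hac hcd hdb
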